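/- All tt-categories (tensor-triangulated categories: triangulated categories with a symmetric monoidal structure $(\otimes,\mathbb 1)$ that is exact in each variable) are idempotent complete; a tt-functor is an exact, strong symmetric monoidal functor. A tt-ring in $\mathcal K$ is a commutative ring object $A$ in $\mathcal K$ that is separable, i.e. whose multiplication $\mu:A\otimes A\to A$ has a section that is a morphism of $A,A$-bimodules. A splitting tower of $A$ is a sequence of homomorphisms of tt-rings $A^{[0]}\to A^{[1]}\to A^{[2]}\to\cdots$ with $A^{[0]}=\mathbb 1$ and $A^{[1]}=A$ such that for every $n\ge1$ there is an isomorphism of $A^{[n]}$-algebras $h:A^{[n]}\otimes_{A^{[n-1]}}A^{[n]}\to A^{[n]}\times A^{[n+1]}$ with $\mathrm{pr}_1 h=\mu$; it is unique up to isomorphism. The degree $\deg(A)\in\mathbb N\cup\{\infty\}$ is the supremum of the $n$ with $A^{[n]}\ne0$ (and $0$ if there is no such $n$, which only happens in the zero category). The same definitions apply in the symmetric monoidal category $B\text{-Mod}_{\mathcal K}$ of modules over a tt-ring $B$, with $\otimes_B$; $F_B:\mathcal K\to B\text{-Mod}_{\mathcal K}$, $x\mapsto B\otimes x$, is extension of scalars.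 The support $\operatorname{supp}(x)$ is the set of those primes $\mathcal P$ (proper thick triangulated $\otimes$-ideals such that $x\otimes y\in\mathcal P$ implies $x\in\mathcal P$ or $y\in\mathcal P$) which do not contain $x$. An object is $\otimes$-nilpotent if some tensor power $x^{\otimes m}$, $m\ge 0$, is zero. Theorem. Let $A$ be a tt-ring in a tt-category $\mathcal K$. (a) Let $F:\mathcal K\to\mathcal L$ be a tt-functor between tt-categories. Then $A$ and $F(A)$ have splitting towers, and $F(A)^{[n]}\simeq F(A^{[n]})$ as tt-rings for every $n\ge0$. In particular $\deg(F(A))\le\deg(A)$. (b) Let $F:\mathcal K\to\mathcal L$ be a tt-functor between tt-categories. Suppose that $F$ is weakly conservative on $\operatorname{supp}(A)$, i.e. every $x\in\mathcal K$ with $\operatorname{supp}(x)\subseteq\operatorname{supp}(A)$ and $F(x)=0$ is $\otimes$-nilpotent; this holds for instance if $F$ is conservative. Then $\deg(F(A))=\deg(A)$. (c) Let $B$ be a tt-ring in $\mathcal K$ with $\operatorname{supp}(B)\supseteq\operatorname{supp}(A)$. Then $\deg(A)$ equals the degree of $F_B(A)$ in $B\text{-Mod}_{\mathcal K}$. (d)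 Suppose that $\mathcal K$ is local, i.e. $x\otimes y=0$ implies that $x$ or $y$ is $\otimes$-nilpotent, and let $B\neq0$ be a tt-ring in $\mathcal K$. Then $\deg(A)$ equals the degree of $F_B(A)$ in $B\text{-Mod}_{\mathcal K}$. -/

import Mathlib

open CategoryTheory MonoidalCategory Limits

set_option linter.unusedSectionVars false

universe v u v' u'

section Separable

open scoped MonObj

variable {C : Type u} [Category.{v} C] [MonoidalCategory C]

/-- A monoid object `B` is separable if its multiplication `μ : B ⊗ B ⟶ B` admits a section
`σ : B ⟶ B ⊗ B` which is a morphism of `B,B`-bimodules. -/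
class IsSeparableMon (B : C) [MonObj B] : Prop where
  exists_section : ∃ σ : B ⟶ B ⊗ B, σ ≫ μ = 𝟙 B ∧
    B ◁ σ ≫ (α_ B B B).inv ≫ μ ▷ B = μ ≫ σ ∧
    σ ▷ B ≫ (α_ B B B).hom ≫ B ◁ μ = μ ≫ σ

end Separable

namespace RelTensor

open scoped MonObj

variable {C : Type u} [Category.{v} C] [MonoidalCategory C] [SymmetricCategory C]
  {B : C} [MonObj B]

/-- The left action of `B` on a module. -/
def lact (X : Mod C B) : B ⊗ X.X ⟶ X.X := ModObj.smul (M := B) (X := X.X)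

/-- The right action of `B` on a (left) module, obtained through the symmetry. -/
def ract (X : Mod C B) : X.X ⊗ B ⟶ X.X := (β_ X.X B).hom ≫ lact X

/-- A module from an explicit action map. -/
abbrev mkMod (X : C) (a : B ⊗ X ⟶ X) (h₁ : η ▷ X ≫ a = (λ_ X).hom)
    (h₂ : μ ▷ X ≫ a = (α_ B B X).hom ≫ B ◁ a ≫ a) : Mod C B :=
  letI : ModObj B X := { smul := a, one_smul := h₁, mul_smul := h₂ }
  ⟨X⟩

/-- A morphism of modules from an explicit equation. -/
def mkHom {X Y : Mod C B} (f : X.X ⟶ Y.X) (h : lact X ≫ f = B ◁ f ≫ lact Y) : X ⟶ Y :=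
  Mod.Hom.mk' f h

@[simp] lemma mkHom_hom {X Y : Mod C B} (f : X.X ⟶ Y.X) (h : lact X ≫ f = B ◁ f ≫ lact Y) :
    (mkHom f h).hom = f := rfl

lemma lact_hom {X Y : Mod C B} (f : X ⟶ Y) : lact X ≫ f.hom = B ◁ f.hom ≫ lact Y :=
  IsModHom.smul_hom

lemma ract_hom {X Y : Mod C B} (f : X ⟶ Y) : ract X ≫ f.hom = f.hom ▷ B ≫ ract Y := by
  simp [ract, lact_hom]

lemma lact_one (X : Mod C B) : η ▷ X.X ≫ lact X = (λ_ X.X).hom := ModObj.one_smul (M := B) X.X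

lemma lact_mul (X : Mod C B) : μ ▷ X.X ≫ lact X = (α_ B B X.X).hom ≫ B ◁ lact X ≫ lact X :=
  ModObj.mul_smul (M := B) X.X

lemma ract_one (X : Mod C B) : X.X ◁ η ≫ ract X = (ρ_ X.X).hom := by
  simp [ract, lact_one]

lemma ract_mul [IsCommMonObj B] (X : Mod C B) :
    X.X ◁ μ ≫ ract X = (α_ X.X B B).inv ≫ ract X ▷ B ≫ ract X := by
  have h : X.X ◁ μ ≫ ract X = X.X ◁ ((β_ B B).hom ≫ μ) ≫ ract X := by
    rw [IsCommMonObj.mul_comm]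
  rw [h]
  simp only [ract, whiskerLeft_comp, Category.assoc, BraidedCategory.braiding_naturality_right_assoc, lact_mul]
  simp only [comp_whiskerRight, Category.assoc, BraidedCategory.braiding_naturality_left_assoc]
  rw [← BraidedCategory.braiding_naturality_left_assoc]
  simp

lemma lact_ract [IsCommMonObj B] (X : Mod C B) :
    lact X ▷ B ≫ ract X = (α_ B X.X B).hom ≫ B ◁ ract X ≫ lact X := by
  have h : (β_ B B).hom ▷ X.X ≫ μ ▷ X.X ≫ lact X = μ ▷ X.X ≫ lact X := by
    rw [← comp_whiskerRight_assoc, IsCommMonObj.mul_comm]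
  simp only [lact_mul] at h
  simp [ract, h]


/-- A chosen bimodule section of the multiplication of a separable monoid object. -/
noncomputable def sec (B : C) [MonObj B] [IsSeparableMon B] : B ⟶ B ⊗ B :=
  (IsSeparableMon.exists_section (B := B)).choose

lemma sec_mul (B : C) [MonObj B] [IsSeparableMon B] : sec B ≫ μ = 𝟙 B :=
  (IsSeparableMon.exists_section (B := B)).choose_spec.1

lemma sec_left (B : C) [MonObj B] [IsSeparableMon B] :
    B ◁ sec B ≫ (α_ B B B).inv ≫ μ ▷ B = μ ≫ sec B :=
  (IsSeparableMon.exists_section (B := B)).choose_spec.2.1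

lemma sec_right (B : C) [MonObj B] [IsSeparableMon B] :
    sec B ▷ B ≫ (α_ B B B).hom ≫ B ◁ μ = μ ≫ sec B :=
  (IsSeparableMon.exists_section (B := B)).choose_spec.2.2

/-- `φ` coequalizes the two maps `X ⊗ B ⊗ Y ⇉ X ⊗ Y`. -/
def Balanced (X Y : Mod C B) {Z : C} (φ : X.X ⊗ Y.X ⟶ Z) : Prop :=
  ract X ▷ Y.X ≫ φ = (α_ X.X B Y.X).hom ≫ X.X ◁ lact Y ≫ φ

/-- Insert `t : W ⟶ B ⊗ B` between two modules and let the two factors act. -/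
def insertMid (X Y : Mod C B) {W : C} (t : W ⟶ B ⊗ B) : X.X ⊗ (W ⊗ Y.X) ⟶ X.X ⊗ Y.X :=
  X.X ◁ (t ▷ Y.X ≫ (α_ B B Y.X).hom) ≫ (α_ X.X B (B ⊗ Y.X)).inv ≫ (ract X ⊗ₘ lact Y)

/-- The endomorphism
`X ⊗ Y ⟶ X ⊗ B ⊗ Y ⟶ X ⊗ B ⊗ B ⊗ Y ⟶ X ⊗ Y` given by `1 ⊗ η ⊗ 1`, `1 ⊗ σ ⊗ 1` and the two
actions; its image is `X ⊗_B Y`. -/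
noncomputable def relIdem [IsSeparableMon B] (X Y : Mod C B) : X.X ⊗ Y.X ⟶ X.X ⊗ Y.X :=
  X.X ◁ (λ_ Y.X).inv ≫ insertMid X Y (η ≫ sec B)

/-- A map splitting the pair of action maps `X ⊗ B ⊗ Y ⇉ X ⊗ Y`. -/
noncomputable def relSplit [IsSeparableMon B] (X Y : Mod C B) :
    X.X ⊗ Y.X ⟶ (X.X ⊗ B) ⊗ Y.X :=
  X.X ◁ (λ_ Y.X).inv ≫ X.X ◁ ((η ≫ sec B) ▷ Y.X ≫ (α_ B B Y.X).hom) ≫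
    (α_ X.X B (B ⊗ Y.X)).inv ≫ (X.X ⊗ B) ◁ lact Y

lemma relSplit_fst [IsSeparableMon B] (X Y : Mod C B) :
    relSplit X Y ≫ ract X ▷ Y.X = relIdem X Y := by
  simp only [relSplit, relIdem, insertMid, tensorHom_def', Category.assoc]

lemma relSplit_snd [IsSeparableMon B] (X Y : Mod C B) :
    relSplit X Y ≫ (α_ X.X B Y.X).hom ≫ X.X ◁ lact Y = 𝟙 _ := by
  have h1 : B ◁ lact Y ≫ lact Y = (α_ B B Y.X).inv ≫ μ ▷ Y.X ≫ lact Y := by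
    simp [lact_mul]
  have h2 : (sec B ▷ Y.X) ≫ μ ▷ Y.X = 𝟙 _ := by
    rw [← comp_whiskerRight, sec_mul, id_whiskerRight]
  simp only [relSplit, Category.assoc, associator_naturality_right_assoc, Iso.inv_hom_id_assoc,
    ← whiskerLeft_comp, h1, comp_whiskerRight, Iso.hom_inv_id_assoc, reassoc_of% h2, lact_one]
  simp

lemma relIdem_absorb [IsSeparableMon B] (X Y : Mod C B) {Z : C} (φ : X.X ⊗ Y.X ⟶ Z)
    (h : Balanced X Y φ) : relIdem X Y ≫ φ = φ := by
  rw [← relSplit_fst, Category.assoc, h]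
  simpa using relSplit_snd X Y =≫ φ

lemma relIdem_absorb_right [IsSeparableMon B] (X Y : Mod C B) {V Z : C}
    (φ : (X.X ⊗ Y.X) ⊗ V ⟶ Z)
    (h : ract X ▷ Y.X ▷ V ≫ φ = (α_ X.X B Y.X).hom ▷ V ≫ (X.X ◁ lact Y) ▷ V ≫ φ) :
    relIdem X Y ▷ V ≫ φ = φ := by
  rw [← relSplit_fst, comp_whiskerRight, Category.assoc, h]
  have e := congrArg (fun t => t ▷ V ≫ φ) (relSplit_snd X Y)
  simpa using e

lemma relIdem_absorb_left [IsSeparableMon B] (X Y : Mod C B) {V Z : C}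
    (φ : V ⊗ (X.X ⊗ Y.X) ⟶ Z)
    (h : V ◁ (ract X ▷ Y.X) ≫ φ = V ◁ (α_ X.X B Y.X).hom ≫ V ◁ X.X ◁ lact Y ≫ φ) :
    V ◁ relIdem X Y ≫ φ = φ := by
  rw [← relSplit_fst, MonoidalCategory.whiskerLeft_comp, Category.assoc, h]
  have e := congrArg (fun t => V ◁ t ≫ φ) (relSplit_snd X Y)
  simpa using e

lemma relIdem_balanced [IsCommMonObj B] [IsSeparableMon B] (X Y : Mod C B) :
    Balanced X Y (relIdem X Y) := by
  have h1 : (ρ_ B).inv ≫ B ◁ (η ≫ sec B) ≫ (α_ B B B).inv ≫ μ ▷ B = sec B := by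
    rw [whiskerLeft_comp, Category.assoc, sec_left]; simp
  have h2 : (λ_ B).inv ≫ (η ≫ sec B) ▷ B ≫ (α_ B B B).hom ≫ B ◁ μ = sec B := by
    rw [comp_whiskerRight, Category.assoc, sec_right]; simp
  have e1 : ract X ▷ Y.X ≫ relIdem X Y = (α_ _ _ _).hom ≫
      insertMid X Y ((ρ_ B).inv ≫ B ◁ (η ≫ sec B) ≫ (α_ B B B).inv ≫ μ ▷ B) := by
    have h3 : ract X ▷ B ≫ ract X = (α_ X.X B B).hom ≫ X.X ◁ μ ≫ ract X := by
      simp [ract_mul]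
    simp only [relIdem, insertMid, MonoidalCategory.tensorHom_def, ← whisker_exchange_assoc]
    rw [associator_inv_naturality_left_assoc, ← comp_whiskerRight_assoc, h3]
    monoidal
  have e2 : (α_ X.X B Y.X).hom ≫ X.X ◁ lact Y ≫ relIdem X Y = (α_ _ _ _).hom ≫
      insertMid X Y ((λ_ B).inv ≫ (η ≫ sec B) ▷ B ≫ (α_ B B B).hom ≫ B ◁ μ) := by
    have h3 : B ◁ lact Y ≫ lact Y = (α_ B B Y.X).inv ≫ μ ▷ Y.X ≫ lact Y := by
      simp [lact_mul]
    have h4 : X.X ◁ lact Y ≫ relIdem X Y = X.X ◁ ((λ_ _).inv ≫ (η ≫ sec B) ▷ (B ⊗ Y.X) ≫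
        (α_ B B _).hom) ≫ (α_ X.X B _).inv ≫ (X.X ⊗ B) ◁ (B ◁ lact Y ≫ lact Y) ≫
          ract X ▷ Y.X := by
      have h5 : lact Y ≫ (λ_ Y.X).inv ≫ (η ≫ sec B) ▷ Y.X ≫ (α_ B B Y.X).hom =
          (λ_ _).inv ≫ (η ≫ sec B) ▷ (B ⊗ Y.X) ≫ (α_ B B _).hom ≫ B ◁ B ◁ lact Y := by
        rw [leftUnitor_inv_naturality_assoc, whisker_exchange_assoc]
        simp
      simp only [relIdem, insertMid, tensorHom_def']
      simp only [← whiskerLeft_comp_assoc, h5]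
      monoidal
    rw [h4, h3]
    simp only [insertMid, tensorHom_def']
    monoidal
  rw [Balanced, e1, e2, h1, h2]

lemma relIdem_lact [IsCommMonObj B] [IsSeparableMon B] (X Y : Mod C B) :
    B ◁ relIdem X Y ≫ (α_ B X.X Y.X).inv ≫ lact X ▷ Y.X =
      (α_ B X.X Y.X).inv ≫ lact X ▷ Y.X ≫ relIdem X Y := by
  have h : B ◁ ract X ≫ lact X = (α_ B X.X B).inv ≫ lact X ▷ B ≫ ract X := by
    simp [lact_ract]
  have h4 : B ◁ relIdem X Y ≫ (α_ B X.X Y.X).inv ≫ lact X ▷ Y.X =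
      B ◁ (X.X ◁ ((λ_ Y.X).inv ≫ (η ≫ sec B) ▷ Y.X ≫ (α_ B B Y.X).hom ≫ B ◁ lact Y) ≫
        (α_ X.X B Y.X).inv) ≫ (α_ B (X.X ⊗ B) Y.X).inv ≫ (B ◁ ract X ≫ lact X) ▷ Y.X := by
    simp only [relIdem, insertMid, tensorHom_def']
    monoidal
  rw [h4, h]
  simp only [relIdem, insertMid, tensorHom_def', ← whisker_exchange_assoc,
    associator_inv_naturality_left_assoc]
  monoidal

lemma relIdem_idem [IsCommMonObj B] [IsSeparableMon B] (X Y : Mod C B) :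
    relIdem X Y ≫ relIdem X Y = relIdem X Y :=
  relIdem_absorb X Y _ (relIdem_balanced X Y)


instance isSplitEpi_whiskerRight {X Y : C} (f : X ⟶ Y) [IsSplitEpi f] (Z : C) :
    IsSplitEpi (f ▷ Z) :=
  IsSplitEpi.mk' { section_ := section_ f ▷ Z, id := by simp [← comp_whiskerRight] }

instance isSplitEpi_whiskerLeft {X Y : C} (f : X ⟶ Y) [IsSplitEpi f] (Z : C) :
    IsSplitEpi (Z ◁ f) :=
  IsSplitEpi.mk' { section_ := Z ◁ section_ f, id := by simp [← MonoidalCategory.whiskerLeft_comp] }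

variable [IsCommMonObj B] [IsSeparableMon B] [IsIdempotentComplete C]

lemma exists_image (X Y : Mod C B) : ∃ (Q : C) (i : Q ⟶ X.X ⊗ Y.X) (p : X.X ⊗ Y.X ⟶ Q),
    i ≫ p = 𝟙 Q ∧ p ≫ i = relIdem X Y :=
  IsIdempotentComplete.idempotents_split _ _ (relIdem_idem X Y)

/-- The object underlying `X ⊗_B Y`: the image of the idempotent `relIdem X Y`. -/
noncomputable def relObj (X Y : Mod C B) : C := (exists_image X Y).choose

/-- The inclusion of `X ⊗_B Y` as a direct summand of `X ⊗ Y`. -/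
noncomputable def relι (X Y : Mod C B) : relObj X Y ⟶ X.X ⊗ Y.X :=
  (exists_image X Y).choose_spec.choose

/-- The projection of `X ⊗ Y` onto `X ⊗_B Y`. -/
noncomputable def relπ (X Y : Mod C B) : X.X ⊗ Y.X ⟶ relObj X Y :=
  (exists_image X Y).choose_spec.choose_spec.choose

lemma relι_relπ (X Y : Mod C B) : relι X Y ≫ relπ X Y = 𝟙 _ :=
  (exists_image X Y).choose_spec.choose_spec.choose_spec.1

lemma relπ_relι (X Y : Mod C B) : relπ X Y ≫ relι X Y = relIdem X Y :=
  (exists_image X Y).choose_spec.choose_spec.choose_spec.2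

instance (X Y : Mod C B) : IsSplitEpi (relπ X Y) :=
  IsSplitEpi.mk' { section_ := relι X Y, id := relι_relπ X Y }

lemma relIdem_relπ (X Y : Mod C B) : relIdem X Y ≫ relπ X Y = relπ X Y := by
  rw [← relπ_relι, Category.assoc, relι_relπ, Category.comp_id]

lemma relπ_balanced (X Y : Mod C B) : Balanced X Y (relπ X Y) := by
  have h := relIdem_balanced X Y
  unfold Balanced at h ⊢
  rw [← relIdem_relπ, reassoc_of% h]

lemma relπ_bal {X Y : Mod C B} {Z : C} (f : relObj X Y ⟶ Z) : ract X ▷ Y.X ≫ relπ X Y ≫ f =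
    (α_ X.X B Y.X).hom ≫ X.X ◁ lact Y ≫ relπ X Y ≫ f := by
  have h := relπ_balanced X Y
  unfold Balanced at h
  rw [reassoc_of% h]

lemma relπ_desc {X Y : Mod C B} {Z : C} (φ : X.X ⊗ Y.X ⟶ Z) (h : Balanced X Y φ) :
    relπ X Y ≫ relι X Y ≫ φ = φ := by
  rw [← Category.assoc, relπ_relι, relIdem_absorb X Y φ h]

lemma whiskerLeft_act_aux (X Y : Mod C B) :
    B ◁ relπ X Y ≫ B ◁ relι X Y ≫ (α_ B X.X Y.X).inv ≫ lact X ▷ Y.X ≫ relπ X Y =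
      (α_ B X.X Y.X).inv ≫ lact X ▷ Y.X ≫ relπ X Y := by
  rw [← MonoidalCategory.whiskerLeft_comp_assoc, relπ_relι]
  have h := relIdem_lact X Y
  rw [reassoc_of% h, relIdem_relπ]

/-- The tensor product `X ⊗_B Y` of `B`-modules. -/
noncomputable def tens (X Y : Mod C B) : Mod C B :=
  mkMod (relObj X Y) (B ◁ relι X Y ≫ (α_ B X.X Y.X).inv ≫ lact X ▷ Y.X ≫ relπ X Y)
    (by
      rw [← cancel_epi (𝟙_ C ◁ relπ X Y), whisker_exchange_assoc, whiskerLeft_act_aux]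
      have h := lact_one X
      simp [← comp_whiskerRight_assoc, h])
    (by
      rw [← cancel_epi ((B ⊗ B) ◁ relπ X Y), whisker_exchange_assoc, whiskerLeft_act_aux,
        associator_naturality_right_assoc, ← MonoidalCategory.whiskerLeft_comp_assoc B (B ◁ relπ X Y),
        whiskerLeft_act_aux]
      simp only [MonoidalCategory.whiskerLeft_comp, Category.assoc, whiskerLeft_act_aux]
      have h := lact_mul X
      rw [associator_inv_naturality_left_assoc, ← comp_whiskerRight_assoc, h]
      simp)

/-- The projection `X ⊗ Y ⟶ X ⊗_B Y`. -/
noncomputable def pr (X Y : Mod C B) : X.X ⊗ Y.X ⟶ (tens X Y).X := relπ X Y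

/-- The inclusion `X ⊗_B Y ⟶ X ⊗ Y`. -/
noncomputable def inc (X Y : Mod C B) : (tens X Y).X ⟶ X.X ⊗ Y.X := relι X Y

instance (X Y : Mod C B) : IsSplitEpi (pr X Y) :=
  IsSplitEpi.mk' { section_ := inc X Y, id := relι_relπ X Y }

lemma pr_balanced (X Y : Mod C B) : ract X ▷ Y.X ≫ pr X Y =
    (α_ X.X B Y.X).hom ≫ X.X ◁ lact Y ≫ pr X Y := relπ_balanced X Y

lemma pr_balanced_assoc {X Y : Mod C B} {Z : C} (f : (tens X Y).X ⟶ Z) :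
    ract X ▷ Y.X ≫ pr X Y ≫ f = (α_ X.X B Y.X).hom ≫ X.X ◁ lact Y ≫ pr X Y ≫ f := by
  rw [← Category.assoc, pr_balanced]; simp

lemma pr_inc (X Y : Mod C B) : pr X Y ≫ inc X Y = relIdem X Y := relπ_relι X Y

lemma pr_desc {X Y : Mod C B} {Z : C} (φ : X.X ⊗ Y.X ⟶ Z) (h : ract X ▷ Y.X ≫ φ =
    (α_ X.X B Y.X).hom ≫ X.X ◁ lact Y ≫ φ) : pr X Y ≫ inc X Y ≫ φ = φ :=
  relπ_desc φ h

lemma pr_lact (X Y : Mod C B) : B ◁ pr X Y ≫ lact (tens X Y) =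
    (α_ B X.X Y.X).inv ≫ lact X ▷ Y.X ≫ pr X Y :=
  whiskerLeft_act_aux X Y

lemma pr_lact_assoc {X Y : Mod C B} {Z : C} (f : (tens X Y).X ⟶ Z) :
    B ◁ pr X Y ≫ lact (tens X Y) ≫ f =
    (α_ B X.X Y.X).inv ≫ lact X ▷ Y.X ≫ pr X Y ≫ f := by
  rw [← Category.assoc, pr_lact]; simp

lemma pr_ract (X Y : Mod C B) : pr X Y ▷ B ≫ ract (tens X Y) =
    (α_ X.X Y.X B).hom ≫ X.X ◁ ract Y ≫ pr X Y := by
  have h := pr_balanced X Y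
  simp only [ract, comp_whiskerRight, Category.assoc] at h
  simp [ract, pr_lact, h]

lemma pr_ract_assoc {X Y : Mod C B} {Z : C} (f : (tens X Y).X ⟶ Z) :
    pr X Y ▷ B ≫ ract (tens X Y) ≫ f =
    (α_ X.X Y.X B).hom ≫ X.X ◁ ract Y ≫ pr X Y ≫ f := by
  rw [← Category.assoc, pr_ract]; simp

/-- Descend a balanced linear map to a morphism out of `X ⊗_B Y`. -/
noncomputable def descHom {X Y Z : Mod C B} (φ : X.X ⊗ Y.X ⟶ Z.X)
    (h : ract X ▷ Y.X ≫ φ = (α_ X.X B Y.X).hom ≫ X.X ◁ lact Y ≫ φ)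
    (h' : (α_ B X.X Y.X).inv ≫ lact X ▷ Y.X ≫ φ = B ◁ φ ≫ lact Z) : tens X Y ⟶ Z :=
  mkHom (inc X Y ≫ φ) (by
    rw [← cancel_epi (B ◁ pr X Y), pr_lact_assoc, pr_desc φ h, h',
      ← MonoidalCategory.whiskerLeft_comp_assoc, pr_desc φ h])

lemma pr_descHom {X Y Z : Mod C B} (φ : X.X ⊗ Y.X ⟶ Z.X)
    (h : ract X ▷ Y.X ≫ φ = (α_ X.X B Y.X).hom ≫ X.X ◁ lact Y ≫ φ)
    (h' : (α_ B X.X Y.X).inv ≫ lact X ▷ Y.X ≫ φ = B ◁ φ ≫ lact Z) :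
    pr X Y ≫ (descHom φ h h').hom = φ := pr_desc φ h

lemma tens_hom_ext {X Y Z : Mod C B} {f g : tens X Y ⟶ Z}
    (h : pr X Y ≫ f.hom = pr X Y ≫ g.hom) : f = g := by
  ext
  rwa [← cancel_epi (pr X Y)]

lemma tens_hom_ext₃ {X Y Z W : Mod C B} {f g : tens (tens X Y) Z ⟶ W}
    (h : pr X Y ▷ Z.X ≫ pr (tens X Y) Z ≫ f.hom = pr X Y ▷ Z.X ≫ pr (tens X Y) Z ≫ g.hom) :
    f = g := by
  apply tens_hom_ext
  rwa [← cancel_epi (pr X Y ▷ Z.X)]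

lemma tens_hom_ext₃' {X Y Z W : Mod C B} {f g : tens X (tens Y Z) ⟶ W}
    (h : X.X ◁ pr Y Z ≫ pr X (tens Y Z) ≫ f.hom = X.X ◁ pr Y Z ≫ pr X (tens Y Z) ≫ g.hom) :
    f = g := by
  apply tens_hom_ext
  rwa [← cancel_epi (X.X ◁ pr Y Z)]

/-- The tensor product of two morphisms of modules. -/
noncomputable def tensHom {X Y X' Y' : Mod C B} (f : X ⟶ X') (g : Y ⟶ Y') :
    tens X Y ⟶ tens X' Y' :=
  descHom ((f.hom ⊗ₘ g.hom) ≫ pr X' Y')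
    (by
      have e₁ : ract X ▷ Y.X ≫ (f.hom ⊗ₘ g.hom) = ((f.hom ⊗ₘ 𝟙 B) ⊗ₘ g.hom) ≫ ract X' ▷ Y'.X := by
        simp only [← tensorHom_id, tensorHom_comp_tensorHom, ract_hom, Category.id_comp,
          Category.comp_id]
      have e₂ : X.X ◁ lact Y ≫ (f.hom ⊗ₘ g.hom) = (f.hom ⊗ₘ (𝟙 B ⊗ₘ g.hom)) ≫ X'.X ◁ lact Y' := by
        simp only [← id_tensorHom, tensorHom_comp_tensorHom, lact_hom, Category.id_comp,
          Category.comp_id]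
      rw [reassoc_of% e₁, reassoc_of% e₂, pr_balanced, associator_naturality_assoc])
    (by
      rw [MonoidalCategory.whiskerLeft_comp, Category.assoc, pr_lact]
      have e₁ : lact X ▷ Y.X ≫ (f.hom ⊗ₘ g.hom) = ((𝟙 B ⊗ₘ f.hom) ⊗ₘ g.hom) ≫ lact X' ▷ Y'.X := by
        simp only [← id_tensorHom, ← tensorHom_id, tensorHom_comp_tensorHom, lact_hom,
          Category.id_comp, Category.comp_id]
      rw [reassoc_of% e₁, ← associator_inv_naturality_assoc, id_tensorHom])

lemma pr_tensHom {X Y X' Y' : Mod C B} (f : X ⟶ X') (g : Y ⟶ Y') :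
    pr X Y ≫ (tensHom f g).hom = (f.hom ⊗ₘ g.hom) ≫ pr X' Y' :=
  pr_descHom _ _ _

lemma desc_left {X Y Z : Mod C B} {W : C} (ψ : (X.X ⊗ Y.X) ⊗ Z.X ⟶ W)
    (h₁ : ract X ▷ Y.X ▷ Z.X ≫ ψ = (α_ X.X B Y.X).hom ▷ Z.X ≫ (X.X ◁ lact Y) ▷ Z.X ≫ ψ)
    (h₂ : (α_ X.X Y.X B).hom ▷ Z.X ≫ (X.X ◁ ract Y) ▷ Z.X ≫ ψ =
      (α_ (X.X ⊗ Y.X) B Z.X).hom ≫ (X.X ⊗ Y.X) ◁ lact Z ≫ ψ) :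
    pr X Y ▷ Z.X ≫ pr (tens X Y) Z ≫ inc (tens X Y) Z ≫ inc X Y ▷ Z.X ≫ ψ = ψ := by
  have e : pr X Y ▷ Z.X ≫ inc X Y ▷ Z.X ≫ ψ = ψ := by
    rw [← comp_whiskerRight_assoc, pr_inc, relIdem_absorb_right X Y ψ h₁]
  rw [pr_desc, e]
  rw [← cancel_epi (pr X Y ▷ B ▷ Z.X), ← comp_whiskerRight_assoc, pr_ract]
  simp only [comp_whiskerRight, Category.assoc, e, h₂, associator_naturality_left_assoc,
    ← whisker_exchange_assoc]

lemma desc_right {X Y Z : Mod C B} {W : C} (ψ : X.X ⊗ (Y.X ⊗ Z.X) ⟶ W)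
    (h₁ : X.X ◁ (ract Y ▷ Z.X) ≫ ψ = X.X ◁ (α_ Y.X B Z.X).hom ≫ X.X ◁ Y.X ◁ lact Z ≫ ψ)
    (h₂ : ract X ▷ (Y.X ⊗ Z.X) ≫ ψ = (α_ X.X B (Y.X ⊗ Z.X)).hom ≫
      X.X ◁ (α_ B Y.X Z.X).inv ≫ X.X ◁ (lact Y ▷ Z.X) ≫ ψ) :
    X.X ◁ pr Y Z ≫ pr X (tens Y Z) ≫ inc X (tens Y Z) ≫ X.X ◁ inc Y Z ≫ ψ = ψ := by
  have e : X.X ◁ pr Y Z ≫ X.X ◁ inc Y Z ≫ ψ = ψ := by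
    rw [← MonoidalCategory.whiskerLeft_comp_assoc, pr_inc, relIdem_absorb_left Y Z ψ h₁]
  rw [pr_desc, e]
  rw [← cancel_epi ((X.X ⊗ B) ◁ pr Y Z), whisker_exchange_assoc, e, h₂,
    associator_naturality_right_assoc, ← MonoidalCategory.whiskerLeft_comp_assoc X.X (B ◁ pr Y Z), pr_lact]
  simp only [MonoidalCategory.whiskerLeft_comp, Category.assoc, e]


lemma pr_tensHom_assoc {X Y X' Y' : Mod C B} (f : X ⟶ X') (g : Y ⟶ Y') {Z : C}
    (h : (tens X' Y').X ⟶ Z) :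
    pr X Y ≫ (tensHom f g).hom ≫ h = (f.hom ⊗ₘ g.hom) ≫ pr X' Y' ≫ h := by
  rw [← Category.assoc, pr_tensHom, Category.assoc]

lemma assoc_balanced (X Y Z : Mod C B) :
    pr X Y ▷ Z.X ≫ pr (tens X Y) Z ≫ inc (tens X Y) Z ≫ inc X Y ▷ Z.X ≫
      (α_ X.X Y.X Z.X).hom ≫ X.X ◁ pr Y Z ≫ pr X (tens Y Z) =
      (α_ X.X Y.X Z.X).hom ≫ X.X ◁ pr Y Z ≫ pr X (tens Y Z) := by
  apply desc_left
  · rw [associator_naturality_left_assoc, ← whisker_exchange_assoc, pr_balanced,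
      associator_naturality_right_assoc, ← MonoidalCategory.whiskerLeft_comp_assoc X.X (B ◁ pr Y Z),
      pr_lact]
    simp
  · have h := pr_balanced Y Z
    simp only [associator_naturality_middle_assoc, associator_naturality_right_assoc,
      ← MonoidalCategory.whiskerLeft_comp_assoc, h]
    simp

lemma assocInv_balanced (X Y Z : Mod C B) :
    X.X ◁ pr Y Z ≫ pr X (tens Y Z) ≫ inc X (tens Y Z) ≫ X.X ◁ inc Y Z ≫
      (α_ X.X Y.X Z.X).inv ≫ pr X Y ▷ Z.X ≫ pr (tens X Y) Z =
      (α_ X.X Y.X Z.X).inv ≫ pr X Y ▷ Z.X ≫ pr (tens X Y) Z := by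
  apply desc_right
  · rw [associator_inv_naturality_right_assoc, whisker_exchange_assoc]
    have h := pr_balanced (tens X Y) Z
    have e : pr X Y ▷ (B ⊗ Z.X) ≫ (tens X Y).X ◁ lact Z ≫ pr (tens X Y) Z =
        (α_ _ _ _).inv ≫ (α_ _ _ _).hom ▷ Z.X ≫ (X.X ◁ ract Y) ▷ Z.X ≫ pr X Y ▷ Z.X ≫
          pr (tens X Y) Z := by
      have e' : (tens X Y).X ◁ lact Z ≫ pr (tens X Y) Z =
        (α_ _ _ _).inv ≫ ract (tens X Y) ▷ Z.X ≫ pr (tens X Y) Z := by rw [h]; simp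
      rw [e', associator_inv_naturality_left_assoc, ← comp_whiskerRight_assoc, pr_ract]
      simp
    rw [e]
    simp
  · have h := pr_balanced X Y
    simp only [associator_inv_naturality_middle_assoc, associator_inv_naturality_left_assoc,
      ← comp_whiskerRight_assoc, h]
    simp

/-- The associativity isomorphism, forward direction. -/
noncomputable def assocHom (X Y Z : Mod C B) : tens (tens X Y) Z ⟶ tens X (tens Y Z) :=
  mkHom (inc (tens X Y) Z ≫ inc X Y ▷ Z.X ≫ (α_ X.X Y.X Z.X).hom ≫ X.X ◁ pr Y Z ≫ pr X (tens Y Z))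
    (by
      rw [← cancel_epi (B ◁ pr (tens X Y) Z), ← cancel_epi (B ◁ pr X Y ▷ Z.X), pr_lact_assoc]
      simp only [← MonoidalCategory.whiskerLeft_comp_assoc, assoc_balanced]
      rw [associator_inv_naturality_middle_assoc, ← comp_whiskerRight_assoc, pr_lact]
      simp only [comp_whiskerRight, Category.assoc, assoc_balanced]
      simp only [MonoidalCategory.whiskerLeft_comp, Category.assoc, pr_lact]
      rw [associator_inv_naturality_right_assoc, whisker_exchange_assoc]
      simp)

/-- The associativity isomorphism, backward direction. -/
noncomputable def assocInv (X Y Z : Mod C B) : tens X (tens Y Z) ⟶ tens (tens X Y) Z :=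
  mkHom (inc X (tens Y Z) ≫ X.X ◁ inc Y Z ≫ (α_ X.X Y.X Z.X).inv ≫ pr X Y ▷ Z.X ≫ pr (tens X Y) Z)
    (by
      rw [← cancel_epi (B ◁ pr X (tens Y Z)), ← cancel_epi (B ◁ X.X ◁ pr Y Z), pr_lact_assoc]
      simp only [← MonoidalCategory.whiskerLeft_comp_assoc, assocInv_balanced]
      rw [associator_inv_naturality_right_assoc, whisker_exchange_assoc, assocInv_balanced]
      simp only [MonoidalCategory.whiskerLeft_comp, Category.assoc, pr_lact]
      rw [associator_inv_naturality_middle_assoc, ← comp_whiskerRight_assoc (B ◁ pr X Y), pr_lact]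
      simp)

lemma pr_assocHom (X Y Z : Mod C B) :
    pr X Y ▷ Z.X ≫ pr (tens X Y) Z ≫ (assocHom X Y Z).hom =
      (α_ X.X Y.X Z.X).hom ≫ X.X ◁ pr Y Z ≫ pr X (tens Y Z) :=
  assoc_balanced X Y Z

lemma pr_assocHom_assoc (X Y Z : Mod C B) {W : C} (h : (tens X (tens Y Z)).X ⟶ W) :
    pr X Y ▷ Z.X ≫ pr (tens X Y) Z ≫ (assocHom X Y Z).hom ≫ h =
      (α_ X.X Y.X Z.X).hom ≫ X.X ◁ pr Y Z ≫ pr X (tens Y Z) ≫ h := by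
  have e := congrArg (fun t => t ≫ h) (pr_assocHom X Y Z)
  simpa only [Category.assoc] using e

lemma pr_assocInv (X Y Z : Mod C B) :
    X.X ◁ pr Y Z ≫ pr X (tens Y Z) ≫ (assocInv X Y Z).hom =
      (α_ X.X Y.X Z.X).inv ≫ pr X Y ▷ Z.X ≫ pr (tens X Y) Z :=
  assocInv_balanced X Y Z

lemma pr_assocInv_assoc (X Y Z : Mod C B) {W : C} (h : (tens (tens X Y) Z).X ⟶ W) :
    X.X ◁ pr Y Z ≫ pr X (tens Y Z) ≫ (assocInv X Y Z).hom ≫ h =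
      (α_ X.X Y.X Z.X).inv ≫ pr X Y ▷ Z.X ≫ pr (tens X Y) Z ≫ h := by
  have e := congrArg (fun t => t ≫ h) (pr_assocInv X Y Z)
  simpa only [Category.assoc] using e

variable (B) in
/-- The unit `B`-module. -/
abbrev unitMod : Mod C B :=
  letI : ModObj B B := ModObj.regular B
  ⟨B⟩

lemma lact_unit : lact (unitMod B) = μ[B] := rfl

lemma ract_unit : ract (unitMod B) = μ[B] := by
  change (β_ B B).hom ≫ μ = μ
  exact IsCommMonObj.mul_comm B

lemma act_unit_pr (X : Mod C B) : lact X ≫ (λ_ X.X).inv ≫ η[B] ▷ X.X ≫ pr (unitMod B) X =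
    pr (unitMod B) X := by
  have h : B ◁ lact X ≫ pr (unitMod B) X = (α_ _ _ _).inv ≫ μ[B] ▷ X.X ≫ pr (unitMod B) X := by
    have h' := pr_balanced (unitMod B) X
    rw [ract_unit] at h'
    rw [h']; simp
  rw [leftUnitor_inv_naturality_assoc, whisker_exchange_assoc, h]
  have e : η[B] ▷ (B ⊗ X.X) ≫ (α_ B B X.X).inv ≫ μ[B] ▷ X.X = (α_ _ _ _).inv ≫ (λ_ B).hom ▷ X.X := by
    rw [associator_inv_naturality_left_assoc, ← comp_whiskerRight, MonObj.one_mul]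
  rw [reassoc_of% e]
  simp

lemma unit_act_pr (X : Mod C B) : ract X ≫ (ρ_ X.X).inv ≫ X.X ◁ η[B] ≫ pr X (unitMod B) =
    pr X (unitMod B) := by
  have h := pr_balanced X (unitMod B)
  rw [lact_unit] at h
  have e : (X.X ⊗ B) ◁ η[B] ≫ (α_ X.X B B).hom ≫ X.X ◁ μ[B] = (α_ _ _ _).hom ≫ X.X ◁ (ρ_ B).hom := by
    rw [associator_naturality_right_assoc, ← MonoidalCategory.whiskerLeft_comp, MonObj.mul_one]
  rw [rightUnitor_inv_naturality_assoc, ← whisker_exchange_assoc, h, reassoc_of% e]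
  simp

/-- The left unit isomorphism. -/
noncomputable def lunit (X : Mod C B) : tens (unitMod B) X ≅ X where
  hom := descHom (X := unitMod B) (lact X) (by rw [ract_unit]; exact lact_mul X)
    (by
      have h := lact_mul X
      rw [lact_unit, h]; simp)
  inv := mkHom ((λ_ X.X).inv ≫ η[B] ▷ X.X ≫ pr (unitMod B) X) (by
    rw [act_unit_pr]
    simp only [MonoidalCategory.whiskerLeft_comp, Category.assoc, pr_lact, lact_unit]
    have e : B ◁ η[B] ▷ X.X ≫ (α_ B B X.X).inv ≫ μ[B] ▷ X.X = (α_ _ _ _).inv ≫ (ρ_ B).hom ▷ X.X := by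
      rw [associator_inv_naturality_middle_assoc, ← comp_whiskerRight, MonObj.mul_one]
    rw [reassoc_of% e]
    simp)
  hom_inv_id := tens_hom_ext (by
    simp only [Mod.comp_hom', mkHom_hom]
    rw [← Category.assoc, pr_descHom, act_unit_pr]
    simp)
  inv_hom_id := by
    ext
    simp only [Mod.comp_hom', mkHom_hom, Category.assoc]
    rw [pr_descHom, lact_one]
    simp

lemma pr_lunit (X : Mod C B) : pr (unitMod B) X ≫ (lunit X).hom.hom = lact X :=
  pr_desc (X := unitMod B) (lact X) (by rw [ract_unit]; exact lact_mul X)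

/-- The right unit isomorphism. -/
noncomputable def runit (X : Mod C B) : tens X (unitMod B) ≅ X where
  hom := descHom (Y := unitMod B) (ract X)
    (by
      have h := ract_mul X
      rw [lact_unit, h]; simp)
    (by
      have h := lact_ract X
      rw [h]; simp)
  inv := mkHom ((ρ_ X.X).inv ≫ X.X ◁ η[B] ≫ pr X (unitMod B)) (by
    simp only [MonoidalCategory.whiskerLeft_comp, Category.assoc, pr_lact]
    rw [rightUnitor_inv_naturality_assoc, ← whisker_exchange_assoc]
    simp)
  hom_inv_id := tens_hom_ext (by
    simp only [Mod.comp_hom', mkHom_hom]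
    rw [← Category.assoc, pr_descHom, unit_act_pr]
    simp)
  inv_hom_id := by
    ext
    simp only [Mod.comp_hom', mkHom_hom, Category.assoc]
    rw [pr_descHom, ract_one]
    simp

lemma pr_runit (X : Mod C B) : pr X (unitMod B) ≫ (runit X).hom.hom = ract X :=
  pr_desc (Y := unitMod B) (ract X) (by
    have h := ract_mul X
    rw [lact_unit, h]; simp)

lemma lact_pr_swap (X Y : Mod C B) : lact Y ▷ X.X ≫ pr Y X =
    (β_ B Y.X).hom ▷ X.X ≫ (α_ _ _ _).hom ≫ Y.X ◁ lact X ≫ pr Y X := by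
  rw [← pr_balanced, ract, ← comp_whiskerRight_assoc]
  simp

/-- The symmetry. -/
noncomputable def swapHom (X Y : Mod C B) : tens X Y ⟶ tens Y X :=
  descHom ((β_ X.X Y.X).hom ≫ pr Y X)
    (by
      rw [BraidedCategory.braiding_naturality_left_assoc,
        BraidedCategory.braiding_naturality_right_assoc, lact_pr_swap, ract,
        ← BraidedCategory.braiding_naturality_right_assoc]
      simp)
    (by
      rw [MonoidalCategory.whiskerLeft_comp, Category.assoc, pr_lact, lact_pr_swap]
      simp)

lemma pr_swapHom (X Y : Mod C B) :
    pr X Y ≫ (swapHom X Y).hom = (β_ X.X Y.X).hom ≫ pr Y X :=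
  pr_descHom _ _ _

lemma pr_swapHom_assoc (X Y : Mod C B) {W : C} (h : (tens Y X).X ⟶ W) :
    pr X Y ≫ (swapHom X Y).hom ≫ h = (β_ X.X Y.X).hom ≫ pr Y X ≫ h := by
  have e := congrArg (fun t => t ≫ h) (pr_swapHom X Y)
  simpa only [Category.assoc] using e

lemma tensHom_id (X Y : Mod C B) : tensHom (𝟙 X) (𝟙 Y) = 𝟙 (tens X Y) :=
  tens_hom_ext (by simp [pr_tensHom])

lemma tensHom_comp {X Y Z X' Y' Z' : Mod C B} (f : X ⟶ Y) (f' : X' ⟶ Y') (g : Y ⟶ Z)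
    (g' : Y' ⟶ Z') : tensHom f f' ≫ tensHom g g' = tensHom (f ≫ g) (f' ≫ g') :=
  tens_hom_ext (by simp [pr_tensHom, pr_tensHom_assoc])

lemma lunit_natural {X Y : Mod C B} (f : X ⟶ Y) :
    tensHom (𝟙 (unitMod B)) f ≫ (lunit Y).hom = (lunit X).hom ≫ f :=
  tens_hom_ext (by
    have h := pr_lunit X
    have h' := lact_hom f
    simp only [Mod.comp_hom']
    rw [reassoc_of% h, pr_tensHom_assoc, pr_lunit, h']
    simp)

lemma runit_natural {X Y : Mod C B} (f : X ⟶ Y) :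
    tensHom f (𝟙 (unitMod B)) ≫ (runit Y).hom = (runit X).hom ≫ f :=
  tens_hom_ext (by
    have h := pr_runit X
    have h' := ract_hom f
    simp only [Mod.comp_hom']
    rw [reassoc_of% h, pr_tensHom_assoc, pr_runit, h']
    simp)

lemma assocHom_natural {X₁ X₂ X₃ Y₁ Y₂ Y₃ : Mod C B} (f : X₁ ⟶ Y₁) (g : X₂ ⟶ Y₂) (h : X₃ ⟶ Y₃) :
    tensHom (tensHom f g) h ≫ assocHom Y₁ Y₂ Y₃ = assocHom X₁ X₂ X₃ ≫ tensHom f (tensHom g h) :=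
  tens_hom_ext₃ (by
    have e₁ : pr X₁ X₂ ▷ X₃.X ≫ ((tensHom f g).hom ⊗ₘ h.hom) =
        ((f.hom ⊗ₘ g.hom) ⊗ₘ h.hom) ≫ pr Y₁ Y₂ ▷ Y₃.X := by
      simp only [← tensorHom_id, tensorHom_comp_tensorHom, pr_tensHom, Category.id_comp,
        Category.comp_id]
    have e₂ : X₁.X ◁ pr X₂ X₃ ≫ (f.hom ⊗ₘ (tensHom g h).hom) =
        (f.hom ⊗ₘ (g.hom ⊗ₘ h.hom)) ≫ Y₁.X ◁ pr Y₂ Y₃ := by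
      simp only [← id_tensorHom, tensorHom_comp_tensorHom, pr_tensHom, Category.id_comp,
        Category.comp_id]
    simp only [Mod.comp_hom']
    rw [pr_tensHom_assoc, reassoc_of% e₁, pr_assocHom, pr_assocHom_assoc, pr_tensHom,
      reassoc_of% e₂, associator_naturality_assoc])

lemma tens_pentagon (W X Y Z : Mod C B) :
    tensHom (assocHom W X Y) (𝟙 Z) ≫ assocHom W (tens X Y) Z ≫ tensHom (𝟙 W) (assocHom X Y Z) =
      assocHom (tens W X) Y Z ≫ assocHom W X (tens Y Z) :=
  tens_hom_ext₃ (by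
    rw [← cancel_epi (pr W X ▷ Y.X ▷ Z.X)]
    simp only [Mod.comp_hom', pr_tensHom_assoc, pr_assocHom_assoc, Mod.id_hom', tensorHom_id]
    have e₁ := congrArg (fun t => t ▷ Z.X) (pr_assocHom W X Y)
    have e₂ := congrArg (fun t => W.X ◁ t) (pr_assocHom X Y Z)
    simp only [comp_whiskerRight, MonoidalCategory.whiskerLeft_comp] at e₁ e₂
    rw [reassoc_of% e₁, pr_assocHom_assoc, pr_tensHom, Mod.id_hom', id_tensorHom,
      associator_naturality_middle_assoc, reassoc_of% e₂, associator_naturality_left_assoc,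
      ← whisker_exchange_assoc, pr_assocHom, associator_naturality_right_assoc]
    simp)

lemma tens_triangle (X Y : Mod C B) :
    assocHom X (unitMod B) Y ≫ tensHom (𝟙 X) (lunit Y).hom = tensHom (runit X).hom (𝟙 Y) :=
  tens_hom_ext₃ (by
    simp only [Mod.comp_hom', pr_tensHom, pr_assocHom_assoc, Mod.id_hom', tensorHom_id,
      id_tensorHom]
    rw [← MonoidalCategory.whiskerLeft_comp_assoc, pr_lunit, ← comp_whiskerRight_assoc, pr_runit,
      pr_balanced])

lemma swapHom_swapHom (X Y : Mod C B) : swapHom X Y ≫ swapHom Y X = 𝟙 (tens X Y) :=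
  tens_hom_ext (by simp [pr_swapHom, pr_swapHom_assoc])

lemma swapHom_natural {X Y X' Y' : Mod C B} (f : X ⟶ X') (g : Y ⟶ Y') :
    tensHom f g ≫ swapHom X' Y' = swapHom X Y ≫ tensHom g f :=
  tens_hom_ext (by simp [pr_swapHom, pr_swapHom_assoc, pr_tensHom, pr_tensHom_assoc])

lemma swapHom_hexagon (X Y Z : Mod C B) :
    assocHom X Y Z ≫ swapHom X (tens Y Z) ≫ assocHom Y Z X =
      tensHom (swapHom X Y) (𝟙 Z) ≫ assocHom Y X Z ≫ tensHom (𝟙 Y) (swapHom X Z) :=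
  tens_hom_ext₃ (by
    have e₁ := congrArg (fun t => t ▷ Z.X) (pr_swapHom X Y)
    have e₂ := congrArg (fun t => Y.X ◁ t) (pr_swapHom X Z)
    simp only [comp_whiskerRight, MonoidalCategory.whiskerLeft_comp] at e₁ e₂
    simp only [Mod.comp_hom', pr_tensHom_assoc, pr_assocHom_assoc, Mod.id_hom', tensorHom_id,
      pr_swapHom_assoc]
    rw [reassoc_of% e₁, pr_assocHom_assoc, pr_tensHom, Mod.id_hom', id_tensorHom,
      reassoc_of% e₂, BraidedCategory.braiding_naturality_right_assoc, pr_assocHom]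
    simp)

lemma swapHom_hexagon_reverse (X Y Z : Mod C B) :
    assocInv X Y Z ≫ swapHom (tens X Y) Z ≫ assocInv Z X Y =
      tensHom (𝟙 X) (swapHom Y Z) ≫ assocInv X Z Y ≫ tensHom (swapHom X Z) (𝟙 Y) :=
  tens_hom_ext₃' (by
    have e₁ := congrArg (fun t => t ▷ Y.X) (pr_swapHom X Z)
    have e₂ := congrArg (fun t => X.X ◁ t) (pr_swapHom Y Z)
    simp only [comp_whiskerRight, MonoidalCategory.whiskerLeft_comp] at e₁ e₂
    simp only [Mod.comp_hom', pr_tensHom_assoc, pr_assocInv_assoc, Mod.id_hom', id_tensorHom,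
      pr_swapHom_assoc]
    rw [reassoc_of% e₂, pr_assocInv_assoc, pr_tensHom, Mod.id_hom', tensorHom_id,
      reassoc_of% e₁, BraidedCategory.braiding_naturality_left_assoc, pr_assocInv]
    simp)

/-- The free module `B ⊗ x`. -/
abbrev freeObj (B : C) [MonObj B] (x : C) : Mod C B :=
  mkMod (B ⊗ x) ((α_ B B x).inv ≫ μ[B] ▷ x)
    (by rw [associator_inv_naturality_left_assoc, ← comp_whiskerRight, MonObj.one_mul]; simp)
    (by
      rw [associator_inv_naturality_left_assoc, ← comp_whiskerRight, MonObj.mul_assoc]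
      simp)

section Instances

variable {C : Type u} [Category.{v} C] [MonoidalCategory C] [SymmetricCategory C]
  [IsIdempotentComplete C] {B : C} [MonObj B] [IsCommMonObj B] [IsSeparableMon B]

/-- The tensor product `⊗_B` on the category of modules over a commutative separable monoid. -/
noncomputable instance modStruct : MonoidalCategoryStruct (Mod C B) where
  tensorObj X Y := tens X Y
  tensorHom f g := tensHom f g
  whiskerLeft X _ _ g := tensHom (𝟙 X) g
  whiskerRight f Y := tensHom f (𝟙 Y)
  tensorUnit := unitMod B
  associator X Y Z :=
    { hom := assocHom X Y Z
      inv := assocInv X Y Z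
      hom_inv_id := tens_hom_ext₃ (by simp [pr_assocHom_assoc, pr_assocInv])
      inv_hom_id := tens_hom_ext₃' (by simp [pr_assocHom, pr_assocInv_assoc]) }
  leftUnitor X := lunit X
  rightUnitor X := runit X

noncomputable instance modMonoidal : MonoidalCategory (Mod C B) where
  tensorHom_def f g := by
    change tensHom f g = tensHom f (𝟙 _) ≫ tensHom (𝟙 _) g
    rw [tensHom_comp, Category.comp_id, Category.id_comp]
  id_tensorHom_id X Y := tensHom_id X Y
  tensorHom_comp_tensorHom f g f' g' := tensHom_comp f g f' g'
  whiskerLeft_id X Y := tensHom_id X Y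
  id_whiskerRight X Y := tensHom_id X Y
  associator_naturality f g h := assocHom_natural f g h
  leftUnitor_naturality f := lunit_natural f
  rightUnitor_naturality f := runit_natural f
  pentagon W X Y Z := tens_pentagon W X Y Z
  triangle X Y := tens_triangle X Y

noncomputable instance modSymmetric : SymmetricCategory (Mod C B) where
  braiding X Y := ⟨swapHom X Y, swapHom Y X, swapHom_swapHom X Y, swapHom_swapHom Y X⟩
  braiding_naturality_right X _ _ f := swapHom_natural (𝟙 X) f
  braiding_naturality_left f Z := swapHom_natural f (𝟙 Z)
  hexagon_forward X Y Z := swapHom_hexagon X Y Z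
  hexagon_reverse X Y Z := swapHom_hexagon_reverse X Y Z
  symmetry X Y := swapHom_swapHom X Y

end Instances

section FreeDef

variable {C : Type u} [Category.{v} C] [MonoidalCategory C] (B : C) [MonObj B]

lemma lact_free (x : C) : lact (freeObj B x) = (α_ B B x).inv ≫ μ[B] ▷ x := rfl

lemma act_free_natural {x y : C} (f : x ⟶ y) :
    ((α_ B B x).inv ≫ μ[B] ▷ x) ≫ B ◁ f = B ◁ B ◁ f ≫ (α_ B B y).inv ≫ μ[B] ▷ y := by
  rw [Category.assoc, ← whisker_exchange, associator_inv_naturality_right_assoc]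

/-- The morphism `1 ⊗ f` of free modules. -/
def freeMap {x y : C} (f : x ⟶ y) : freeObj B x ⟶ freeObj B y :=
  mkHom (X := freeObj B x) (Y := freeObj B y) (B ◁ f) (act_free_natural B f)

lemma freeMap_hom {x y : C} (f : x ⟶ y) : (freeMap B f).hom = B ◁ f := rfl

/-- The extension-of-scalars functor `F_B : C ⥤ B-Mod`, `x ↦ B ⊗ x`. -/
def freeMod : C ⥤ Mod C B where
  obj x := freeObj B x
  map f := freeMap B f
  map_id x := by ext; exact MonoidalCategory.whiskerLeft_id B x
  map_comp f g := by ext; exact MonoidalCategory.whiskerLeft_comp B f g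

end FreeDef

section FreeLax

variable {C : Type u} [Category.{v} C] [MonoidalCategory C] [SymmetricCategory C]
  [IsIdempotentComplete C] (B : C) [MonObj B] [IsCommMonObj B] [IsSeparableMon B]

/-- The map `(B ⊗ x) ⊗ (B ⊗ y) ⟶ B ⊗ (x ⊗ y)` multiplying the two copies of `B`. -/
def freeMul (x y : C) : (B ⊗ x) ⊗ (B ⊗ y) ⟶ B ⊗ (x ⊗ y) :=
  tensorμ B x B y ≫ μ[B] ▷ (x ⊗ y)


lemma freeMul_eq (x y : C) : freeMul B x y = (α_ B x (B ⊗ y)).hom ≫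
    B ◁ ((α_ x B y).inv ≫ (β_ x B).hom ▷ y ≫ (α_ B x y).hom) ≫
      (α_ B B (x ⊗ y)).inv ≫ μ[B] ▷ (x ⊗ y) := by
  simp [freeMul, tensorμ]

lemma freeMul_linear (x y : C) : (α_ B (B ⊗ x) (B ⊗ y)).inv ≫
    ((α_ B B x).inv ≫ μ[B] ▷ x) ▷ (B ⊗ y) ≫ freeMul B x y =
      B ◁ freeMul B x y ≫ (α_ B B (x ⊗ y)).inv ≫ μ[B] ▷ (x ⊗ y) := by
  have e : B ◁ (α_ B B (x ⊗ y)).inv ≫ B ◁ μ[B] ▷ (x ⊗ y) ≫ (α_ B B (x ⊗ y)).inv ≫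
      μ[B] ▷ (x ⊗ y) = (α_ B B _).inv ≫ (α_ (B ⊗ B) B _).inv ≫ μ[B] ▷ B ▷ (x ⊗ y) ≫
        μ[B] ▷ (x ⊗ y) := by
    rw [associator_inv_naturality_middle_assoc, ← comp_whiskerRight, ← comp_whiskerRight,
      MonObj.mul_assoc]
    monoidal
  rw [freeMul_eq]
  simp only [MonoidalCategory.whiskerLeft_comp, Category.assoc, e, comp_whiskerRight]
  rw [associator_naturality_left_assoc]
  simp only [← whisker_exchange_assoc]
  rw [associator_inv_naturality_left_assoc]
  monoidal

lemma freeMul_balanced (x y : C) :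
    ((β_ (B ⊗ x) B).hom ≫ (α_ B B x).inv ≫ μ[B] ▷ x) ▷ (B ⊗ y) ≫ freeMul B x y =
      (α_ (B ⊗ x) B (B ⊗ y)).hom ≫ (B ⊗ x) ◁ ((α_ B B y).inv ≫ μ[B] ▷ y) ≫ freeMul B x y := by
  have e₀ : (β_ (B ⊗ x) B).hom ≫ (α_ B B x).inv ≫ μ[B] ▷ x =
      (α_ B x B).hom ≫ B ◁ (β_ x B).hom ≫ (α_ B B x).inv ≫ μ[B] ▷ x := by
    simp [← comp_whiskerRight]
  have e₁ := freeMul_linear B x y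
  rw [Iso.inv_comp_eq] at e₁
  have e₂ : x ◁ ((α_ B B y).inv ≫ μ[B] ▷ y) ≫ (α_ x B y).inv ≫ (β_ x B).hom ▷ y ≫ (α_ B x y).hom =
      (α_ x B (B ⊗ y)).inv ≫ (β_ x B).hom ▷ (B ⊗ y) ≫ (α_ B x (B ⊗ y)).hom ≫
        B ◁ ((α_ x B y).inv ≫ (β_ x B).hom ▷ y ≫ (α_ B x y).hom) ≫ (α_ B B (x ⊗ y)).inv ≫
          μ[B] ▷ (x ⊗ y) := by
    rw [MonoidalCategory.whiskerLeft_comp, Category.assoc, associator_inv_naturality_middle_assoc,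
      ← comp_whiskerRight_assoc (x ◁ μ[B]), BraidedCategory.braiding_naturality_right]
    simp
  rw [e₀]
  calc _ = (α_ B x B).hom ▷ (B ⊗ y) ≫ (B ◁ (β_ x B).hom) ▷ (B ⊗ y) ≫ (α_ B B x).inv ▷ (B ⊗ y) ≫
        μ[B] ▷ x ▷ (B ⊗ y) ≫ freeMul B x y := by simp
    _ = (α_ B x B).hom ▷ (B ⊗ y) ≫ (B ◁ (β_ x B).hom) ▷ (B ⊗ y) ≫ (α_ B (B ⊗ x) (B ⊗ y)).hom ≫
        B ◁ freeMul B x y ≫ (α_ B B (x ⊗ y)).inv ≫ μ[B] ▷ (x ⊗ y) := by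
      simp only [comp_whiskerRight, Category.assoc] at e₁
      rw [e₁]
    _ = (α_ (B ⊗ x) B (B ⊗ y)).hom ≫ (α_ B x (B ⊗ (B ⊗ y))).hom ≫
          B ◁ ((α_ x B (B ⊗ y)).inv ≫ (β_ x B).hom ▷ (B ⊗ y) ≫ (α_ B x (B ⊗ y)).hom ≫
        B ◁ ((α_ x B y).inv ≫ (β_ x B).hom ▷ y ≫ (α_ B x y).hom) ≫ (α_ B B (x ⊗ y)).inv ≫
          μ[B] ▷ (x ⊗ y)) ≫ (α_ B B (x ⊗ y)).inv ≫ μ[B] ▷ (x ⊗ y) := by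
      rw [freeMul_eq]
      simp only [MonoidalCategory.whiskerLeft_comp, Category.assoc]
      monoidal
    _ = _ := by
      rw [← e₂, freeMul_eq, associator_naturality_right_assoc]
      simp only [MonoidalCategory.whiskerLeft_comp, Category.assoc]

lemma freeMul_natural {x x' y y' : C} (f : x ⟶ x') (g : y ⟶ y') :
    (B ◁ f ⊗ₘ B ◁ g) ≫ freeMul B x' y' = freeMul B x y ≫ B ◁ (f ⊗ₘ g) := by
  have h := tensorμ_natural (𝟙 B) f (𝟙 B) g
  simp only [id_tensorHom, MonoidalCategory.whiskerLeft_id] at h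
  simp only [freeMul, reassoc_of% h, Category.assoc, whisker_exchange]

lemma freeMul_assoc (x y z : C) :
    freeMul B x y ▷ (B ⊗ z) ≫ freeMul B (x ⊗ y) z ≫ B ◁ (α_ x y z).hom =
      (α_ (B ⊗ x) (B ⊗ y) (B ⊗ z)).hom ≫ (B ⊗ x) ◁ freeMul B y z ≫ freeMul B x (y ⊗ z) := by
  have h₁ := tensorμ_natural_left μ[B] (𝟙 (x ⊗ y)) B z
  have h₂ := tensorμ_natural_right B x μ[B] (𝟙 (y ⊗ z))
  have h₃ := tensor_associativity B x B y B z
  simp only [tensorHom_id, MonoidalCategory.whiskerLeft_id, id_whiskerRight] at h₁ h₂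
  simp only [freeMul, comp_whiskerRight, MonoidalCategory.whiskerLeft_comp, Category.assoc]
  rw [reassoc_of% h₁, reassoc_of% h₂, ← reassoc_of% h₃]
  congr 2
  simp only [← tensorHom_id, ← id_tensorHom, tensorHom_comp_tensorHom, Category.id_comp,
    Category.comp_id]
  congr 1
  simp

lemma freeMul_one_left (x : C) :
    (ρ_ B).inv ▷ (B ⊗ x) ≫ freeMul B (𝟙_ C) x ≫ B ◁ (λ_ x).hom = (α_ B B x).inv ≫ μ[B] ▷ x := by
  rw [freeMul_eq]
  have h : (β_ (𝟙_ C) B).hom = (λ_ B).hom ≫ (ρ_ B).inv := by simp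
  simp only [Category.assoc, h, ← whisker_exchange]
  monoidal

lemma freeMul_one_right (x : C) :
    (B ⊗ x) ◁ (ρ_ B).inv ≫ freeMul B x (𝟙_ C) ≫ B ◁ (ρ_ x).hom =
      (β_ (B ⊗ x) B).hom ≫ (α_ B B x).inv ≫ μ[B] ▷ x := by
  have e₀ : (β_ (B ⊗ x) B).hom ≫ (α_ B B x).inv ≫ μ[B] ▷ x =
      (α_ B x B).hom ≫ B ◁ (β_ x B).hom ≫ (α_ B B x).inv ≫ μ[B] ▷ x := by
    simp [← comp_whiskerRight]
  rw [e₀, freeMul_eq]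
  simp only [Category.assoc, ← whisker_exchange]
  monoidal

lemma freeMul_braided (x y : C) :
    freeMul B x y ≫ B ◁ (β_ x y).hom = (β_ (B ⊗ x) (B ⊗ y)).hom ≫ freeMul B y x := by
  have h : (β_ (B ⊗ x) (B ⊗ y)).hom ≫ tensorμ B y B x =
      tensorμ B x B y ≫ ((β_ B B).hom ⊗ₘ (β_ x y).hom) := by
    simp [tensorμ, SymmetricCategory.braiding_swap_eq_inv_braiding B y,
      MonoidalCategory.tensorHom_def]
  rw [freeMul, freeMul, reassoc_of% h, MonoidalCategory.tensorHom_def]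
  simp only [Category.assoc]
  rw [whisker_exchange, ← comp_whiskerRight_assoc, IsCommMonObj.mul_comm]

lemma freeUnit_linear : lact (unitMod B) ≫ (ρ_ B).inv =
    B ◁ (ρ_ B).inv ≫ lact (freeObj B (𝟙_ C)) := by
  rw [lact_unit, lact_free]
  monoidal

/-- The unit comparison morphism of extension of scalars. -/
def freeε : unitMod B ⟶ freeObj B (𝟙_ C) :=
  mkHom (X := unitMod B) (Y := freeObj B (𝟙_ C)) (ρ_ B).inv (freeUnit_linear B)

/-- The tensor comparison morphism of extension of scalars. -/
noncomputable def freeμ (x y : C) : tens (freeObj B x) (freeObj B y) ⟶ freeObj B (x ⊗ y) :=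
  descHom (X := freeObj B x) (Y := freeObj B y) (Z := freeObj B (x ⊗ y)) (freeMul B x y)
    (freeMul_balanced B x y) (freeMul_linear B x y)

lemma pr_freeμ (x y : C) : pr (freeObj B x) (freeObj B y) ≫ (freeμ B x y).hom = freeMul B x y :=
  pr_desc (X := freeObj B x) (Y := freeObj B y) _ (freeMul_balanced B x y)

lemma pr_freeμ_assoc (x y : C) {Z : C} (f : B ⊗ (x ⊗ y) ⟶ Z) :
    pr (freeObj B x) (freeObj B y) ≫ (freeμ B x y).hom ≫ f = freeMul B x y ≫ f := by
  rw [← pr_freeμ, Category.assoc]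

lemma freeμ_natural {x x' y y' : C} (f : x ⟶ x') (g : y ⟶ y') :
    tensHom (freeMap B f) (freeMap B g) ≫ freeμ B x' y' =
      freeμ B x y ≫ freeMap B (f ⊗ₘ g) :=
  tens_hom_ext (by
    simp only [Mod.comp_hom', pr_tensHom_assoc, pr_freeμ, freeMap_hom, freeMul_natural]
    rw [pr_freeμ_assoc])

lemma freeμ_assoc (x y z : C) :
    tensHom (freeμ B x y) (𝟙 _) ≫ freeμ B (x ⊗ y) z ≫ freeMap B (α_ x y z).hom =
      assocHom (freeObj B x) (freeObj B y) (freeObj B z) ≫ tensHom (𝟙 _) (freeμ B y z) ≫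
        freeμ B x (y ⊗ z) :=
  tens_hom_ext₃ (by
    have h := freeMul_assoc B x y z
    simp only [Mod.comp_hom', pr_tensHom_assoc, Mod.id_hom', freeMap_hom, tensorHom_id]
    refine Eq.trans ?_ (pr_assocHom_assoc (freeObj B x) (freeObj B y) (freeObj B z) _).symm
    rw [← comp_whiskerRight_assoc, pr_tensHom_assoc, Mod.id_hom', id_tensorHom,
      ← MonoidalCategory.whiskerLeft_comp_assoc, pr_freeμ, pr_freeμ, pr_freeμ, pr_freeμ_assoc]
    exact h)

lemma freeε_left (x : C) : (lunit (freeObj B x)).hom =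
    tensHom (freeε B) (𝟙 _) ≫ freeμ B (𝟙_ C) x ≫ freeMap B (λ_ x).hom :=
  tens_hom_ext (by
    have h := freeMul_one_left B x
    simp only [Mod.comp_hom', pr_tensHom_assoc, Mod.id_hom', freeMap_hom, tensorHom_id, pr_lunit]
    rw [pr_freeμ_assoc]
    exact h.symm)

lemma freeε_right (x : C) : (runit (freeObj B x)).hom =
    tensHom (𝟙 _) (freeε B) ≫ freeμ B x (𝟙_ C) ≫ freeMap B (ρ_ x).hom :=
  tens_hom_ext (by
    have h := freeMul_one_right B x
    simp only [Mod.comp_hom', pr_tensHom_assoc, Mod.id_hom', freeMap_hom, id_tensorHom, pr_runit]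
    rw [pr_freeμ_assoc]
    exact h.symm)

lemma freeμ_braided (x y : C) : freeμ B x y ≫ freeMap B (β_ x y).hom =
    swapHom (freeObj B x) (freeObj B y) ≫ freeμ B y x :=
  tens_hom_ext (by
    have h := freeMul_braided B x y
    simp only [Mod.comp_hom', pr_swapHom_assoc, pr_freeμ, freeMap_hom]
    rw [pr_freeμ_assoc, h])

end FreeLax

end RelTensor

/-- The lax (in fact strong) symmetric monoidal structure on extension of scalars. -/
noncomputable instance freeModLaxBraided {C : Type u} [Category.{v} C] [MonoidalCategory C]
    [SymmetricCategory C] [IsIdempotentComplete C] (B : C) [MonObj B] [IsCommMonObj B]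
    [IsSeparableMon B] : (RelTensor.freeMod B).LaxBraided where
  ε := RelTensor.freeε B
  μ x y := RelTensor.freeμ B x y
  μ_natural_left f x' := by
    have h := RelTensor.freeμ_natural B f (𝟙 x')
    rw [tensorHom_id] at h
    refine Eq.trans ?_ h
    change RelTensor.tensHom (RelTensor.freeMap B f) (𝟙 _) ≫ _ = _
    rw [← (RelTensor.freeMod B).map_id x']
    rfl
  μ_natural_right x' f := by
    have h := RelTensor.freeμ_natural B (𝟙 x') f
    rw [id_tensorHom] at h
    refine Eq.trans ?_ h
    change RelTensor.tensHom (𝟙 _) (RelTensor.freeMap B f) ≫ _ = _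
    rw [← (RelTensor.freeMod B).map_id x']
    rfl
  associativity x y z := RelTensor.freeμ_assoc B x y z
  left_unitality x := RelTensor.freeε_left B x
  right_unitality x := RelTensor.freeε_right B x
  braided x y := RelTensor.freeμ_braided B x y

section Degree

open scoped MonObj

variable {C : Type u} [Category.{v} C] [MonoidalCategory C] [BraidedCategory C]

/-- For homomorphisms `f : R ⟶ S` and `f' : R ⟶ S'` of commutative ring objects, the homomorphisms
`i : S ⟶ Q` and `j : S' ⟶ Q` exhibit the ring object `Q` as the relative tensor product
`S ⊗_R S'`: the map `(i ⊗ j) ≫ μ : S ⊗ S' ⟶ Q` is a coequalizer of the two actions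
`S ⊗ R ⊗ S' ⇉ S ⊗ S'` of `R`. -/
def IsRelTensor {R S S' Q : CommMon C} (f : R ⟶ S) (f' : R ⟶ S') (i : S ⟶ Q) (j : S' ⟶ Q) : Prop :=
  ∃ w : (S.X ◁ f.hom.hom ≫ μ[S.X]) ▷ S'.X ≫ ((i.hom.hom ⊗ₘ j.hom.hom) ≫ μ[Q.X]) =
      ((α_ S.X R.X S'.X).hom ≫ S.X ◁ (f'.hom.hom ▷ S'.X ≫ μ[S'.X])) ≫
        ((i.hom.hom ⊗ₘ j.hom.hom) ≫ μ[Q.X]),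
    Nonempty (IsColimit (Cofork.ofπ ((i.hom.hom ⊗ₘ j.hom.hom) ≫ μ[Q.X]) w))

/-- The homomorphisms `p : Q ⟶ S` and `q : Q ⟶ T` exhibit the ring object `Q` as the product
`S × T`, i.e. as `S ⊕ T` with componentwise structure. -/
def IsRingProduct {Q S T : CommMon C} (p : Q ⟶ S) (q : Q ⟶ T) : Prop :=
  Nonempty (IsLimit (BinaryFan.mk p.hom.hom q.hom.hom))

/-- For `f : R ⟶ S`, the `S`-algebra `g : S ⟶ T` is the `S`-algebra `S'` of the splitting theorem,
applied to `S` over `R`: there is an isomorphism of `S`-algebras `h : S ⊗_R S ≅ S × T` such that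
`pr₁ h` is the multiplication `S ⊗_R S ⟶ S`. Here `Q` is both `S ⊗_R S` (via `i`, `j`) and
`S × T` (via `p`, `q`), and it is an `S`-algebra via the left factor `i`. -/
def IsSplittingStep {R S T : CommMon C} (f : R ⟶ S) (g : S ⟶ T) : Prop :=
  ∃ (Q : CommMon C) (i j : S ⟶ Q) (p : Q ⟶ S) (q : Q ⟶ T),
    IsRelTensor f f i j ∧ IsRingProduct p q ∧ i ≫ p = 𝟙 S ∧ j ≫ p = 𝟙 S ∧ i ≫ q = g

/-- A splitting tower `A^[0] = 𝟙 ⟶ A^[1] = A ⟶ A^[2] ⟶ ⋯` of a commutative ring object `A`: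
commutative separable ring objects with isomorphisms of `A^[n]`-algebras
`h : A^[n] ⊗_{A^[n-1]} A^[n] ≅ A^[n] × A^[n+1]` such that `pr₁ h = μ`, for all `n ≥ 1`. -/
structure SplittingTower (A : CommMon C) where
  /-- The ring object `A^[n]`. -/
  obj : ℕ → CommMon C
  separable : ∀ n, IsSeparableMon (obj n).X
  /-- The homomorphism `A^[n] ⟶ A^[n+1]`. -/
  map : ∀ n, obj n ⟶ obj (n + 1)
  /-- `A^[0]` is the unit. -/
  isoZero : obj 0 ≅ CommMon.trivial C
  /-- `A^[1]` is `A`. -/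
  isoOne : obj 1 ≅ A
  step : ∀ n, IsSplittingStep (map n) (map (n + 1))

/-- The degree of `A`: the last `n` such that `A^[n] ≠ 0`, and `⊤` if there is no last one.
(Splitting towers are unique up to isomorphism. In the zero category the degree is `0`.) -/
noncomputable def ringDegree (A : CommMon C) : ℕ∞ :=
  ⨆ (T : SplittingTower A) (n : ℕ) (_ : ¬ IsZero (T.obj n).X), (n : ℕ∞)

end Degree

section TensorTriangulated

/-- A symmetric monoidal triangulated category whose tensor product is exact in each variable. -/
class IsTensorTriangulated (K : Type u) [Category.{v} K] [Preadditive K] [HasZeroObject K]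
    [HasShift K ℤ] [∀ n : ℤ, (shiftFunctor K n).Additive] [Pretriangulated K]
    [MonoidalCategory K] : Prop where
  exact_left : ∀ x : K, ∃ _ : (tensorLeft x).CommShift ℤ, (tensorLeft x).IsTriangulated
  exact_right : ∀ x : K, ∃ _ : (tensorRight x).CommShift ℤ, (tensorRight x).IsTriangulated

variable {K : Type u} [Category.{v} K] [MonoidalCategory K]

/-- The tensor power `x^{⊗ m}`. -/
def tensorPower (x : K) : ℕ → K
  | 0 => 𝟙_ K
  | m + 1 => tensorPower x m ⊗ x

/-- `x` is `⊗`-nilpotent. -/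
def IsTensorNilpotent (x : K) : Prop := ∃ m : ℕ, IsZero (tensorPower x m)

variable (K) in
/-- `K` is local: `x ⊗ y = 0` implies that `x` or `y` is `⊗`-nilpotent. -/
def IsLocalTT : Prop :=
  ∀ x y : K, IsZero (x ⊗ y) → IsTensorNilpotent x ∨ IsTensorNilpotent y

variable [Preadditive K] [HasZeroObject K] [HasShift K ℤ]
  [∀ n : ℤ, (shiftFunctor K n).Additive] [Pretriangulated K]

/-- Prime ideals of `K`: proper thick triangulated `⊗`-ideals `P` such that `x ⊗ y ∈ P` implies
`x ∈ P` or `y ∈ P`. -/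
structure IsPrimeTTIdeal (P : ObjectProperty K) : Prop where
  triangulated : P.IsTriangulated
  thick : P.IsStableUnderRetracts
  tensor_mem : ∀ x y : K, P x → P (x ⊗ y)
  tensor_mem' : ∀ x y : K, P y → P (x ⊗ y)
  proper : ∃ x : K, ¬ P x
  prime : ∀ x y : K, P (x ⊗ y) → P x ∨ P y

variable (K) in
/-- The set of points of the spectrum `Spc K`. -/
def Spc : Type _ := {P : ObjectProperty K // IsPrimeTTIdeal P}

/-- The support of an object: the primes not containing it. -/
def ttSupp (x : K) : Set (Spc K) := {P | ¬ P.1 x}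

/-- `F` is weakly conservative on a subset `Y` of the spectrum: if `supp x ⊆ Y` and `F x = 0`,
then `x` is `⊗`-nilpotent. -/
def WeaklyConservativeOn {L : Type u'} [Category.{v'} L] (F : K ⥤ L) (Y : Set (Spc K)) : Prop :=
  ∀ x : K, ttSupp x ⊆ Y → IsZero (F.obj x) → IsTensorNilpotent x

end TensorTriangulated

/-! Separability turns every construction in sight into equations, and strong monoidal additive
functors preserve equations. If `R` is separable with bimodule section `σ`, then for `R`-algebras
`S`, `S'` the element `σ(1)`, mapped to `S ⊗ S'`, acts by an idempotent (`algIdem`) whose image is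
`S ⊗_R S'`. Thus the relative tensor product is a split coequalizer, a direct summand of `S ⊗ S'`
and again a ring (`exists_relTensor`, `IsRelTensorHom.map`).

When `S` is separable as well, the multiplication `S ⊗_R S ⟶ S` has a section linear over `S ⊗_R S`.
Its complement is therefore a ring `T`, separable because it is a linear summand of a separable
ring; this is the next stage (`exists_splittingStep`), and iteration gives a tower. Uniqueness has
two ingredients: `S ⊗_R S` is a pushout of commutative rings, and the complement of a ring factor is
determined by the projection to that factor (`section_comp_eq_zero`). Hence `F` applied to a tower
of `A` is, up to isomorphism, the tower of `F(A)`, and the degree can be read from any one tower.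

Equality of degrees asks that `F` kill no nonzero stage `S = A^[n]` with `n ≥ 1`. Such a stage is an
`A`-algebra, hence a retract of `A ⊗ S`, so `supp S ⊆ supp A`; and a `⊗`-nilpotent ring is zero,
being a retract of its positive tensor powers. Weak conservativity then suffices.

For `F = F_B` the condition `F(S) = 0` gives `B ⊗ S = 0`. Under the support hypothesis every prime
contains `S`, so `S` is nilpotent by a Zorn argument (`isTensorNilpotent_of_forall_prime`); in the
local case `B` or `S` is nilpotent outright. Only additivity and strong symmetric monoidality of
`F_B` are needed, so no triangulation of `B`-modules enters. -/

/-! ### Separability under monoidal functors and tensor products. -/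

section SeparableTransport

open scoped MonObj Obj

variable {C : Type u} [Category.{v} C] [MonoidalCategory C]
  {D : Type u'} [Category.{v'} D] [MonoidalCategory D]

/-- A lax monoidal functor whose comparison map is invertible preserves separability. -/
lemma IsSeparableMon.map (F : C ⥤ D) [F.LaxMonoidal] (B : C) [MonObj B] [IsSeparableMon B]
    [IsIso (Functor.LaxMonoidal.μ F B B)] : IsSeparableMon (F.obj B) := by
  obtain ⟨σ, h₁, h₂, h₃⟩ := IsSeparableMon.exists_section (B := B)
  refine ⟨F.map σ ≫ inv (Functor.LaxMonoidal.μ F B B), ?_, ?_, ?_⟩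
  · simp [Functor.obj.μ_def, ← Functor.map_comp, h₁]
  · rw [← cancel_mono (Functor.LaxMonoidal.μ F B B)]
    have e := congrArg F.map h₂
    simp only [Functor.map_comp] at e
    simp only [Functor.obj.μ_def, Category.assoc, IsIso.inv_hom_id, Category.comp_id, ← e,
      comp_whiskerRight, Functor.LaxMonoidal.μ_natural_left]
    rw [← Functor.LaxMonoidal.associativity_inv_assoc, ← MonoidalCategory.whiskerLeft_comp_assoc,
      Category.assoc, IsIso.inv_hom_id, Category.comp_id,
      Functor.LaxMonoidal.μ_natural_right_assoc]
  · rw [← cancel_mono (Functor.LaxMonoidal.μ F B B)]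
    have e := congrArg F.map h₃
    simp only [Functor.map_comp] at e
    simp only [Functor.obj.μ_def, Category.assoc, IsIso.inv_hom_id, Category.comp_id, ← e,
      comp_whiskerRight, MonoidalCategory.whiskerLeft_comp,
      Functor.LaxMonoidal.μ_natural_right, ← Functor.LaxMonoidal.associativity_assoc]
    rw [← comp_whiskerRight_assoc (inv _), IsIso.inv_hom_id,
      id_whiskerRight, Category.id_comp,
      Functor.LaxMonoidal.μ_natural_left_assoc]

/-- The componentwise structure of a monoid object on a pair of monoid objects. -/
abbrev prodMonObj (X : C) (Y : D) [MonObj X] [MonObj Y] : MonObj ((X, Y) : C × D) where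
  one := (η[X], η[Y])
  mul := (μ[X], μ[Y])
  one_mul := Prod.ext (MonObj.one_mul X) (MonObj.one_mul Y)
  mul_one := Prod.ext (MonObj.mul_one X) (MonObj.mul_one Y)
  mul_assoc := Prod.ext (MonObj.mul_assoc X) (MonObj.mul_assoc Y)

lemma IsSeparableMon.prod (X : C) (Y : D) [MonObj X] [MonObj Y] [IsSeparableMon X]
    [IsSeparableMon Y] : letI := prodMonObj X Y; IsSeparableMon ((X, Y) : C × D) := by
  obtain ⟨σ, h₁, h₂, h₃⟩ := IsSeparableMon.exists_section (B := X)
  obtain ⟨τ, k₁, k₂, k₃⟩ := IsSeparableMon.exists_section (B := Y)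
  let := prodMonObj X Y
  exact ⟨(σ, τ), Prod.ext h₁ k₁, Prod.ext h₂ k₂, Prod.ext h₃ k₃⟩

/-- In a braided category `⊗ : C × C ⥤ C` is itself a monoidal functor, and it carries the separable
pair `(X, Y)` to `X ⊗ Y` with its usual ring structure. -/
instance IsSeparableMon.tensor [BraidedCategory C] (X Y : C) [MonObj X] [MonObj Y]
    [IsSeparableMon X] [IsSeparableMon Y] : IsSeparableMon (X ⊗ Y) := by
  let := prodMonObj X Y
  have := IsSeparableMon.prod X Y
  exact IsSeparableMon.map (MonoidalCategory.tensor C) ((X, Y) : C × C)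

end SeparableTransport

/-! ### Quotient rings cut out by linear idempotents. -/

section SplitMon

open scoped MonObj

variable {C : Type u} [Category.{v} C] [MonoidalCategory C]

/-- The quotient of a monoid object by a multiplicative split epimorphism. -/
abbrev splitMonObj {Q T : C} [MonObj Q] (π : Q ⟶ T) [IsSplitEpi π] (m : T ⊗ T ⟶ T)
    (h : (π ⊗ₘ π) ≫ m = μ ≫ π) : MonObj T where
  one := η ≫ π
  mul := m
  one_mul := by
    rw [← cancel_epi (𝟙_ C ◁ π), leftUnitor_naturality, ← MonObj.one_mul, Category.assoc, ← h,
      comp_whiskerRight_assoc, whisker_exchange_assoc, MonoidalCategory.tensorHom_def',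
      Category.assoc]
  mul_one := by
    rw [← cancel_epi (π ▷ 𝟙_ C), rightUnitor_naturality, ← MonObj.mul_one, Category.assoc, ← h,
      MonoidalCategory.whiskerLeft_comp_assoc, ← whisker_exchange_assoc,
      MonoidalCategory.tensorHom_def, Category.assoc]
  mul_assoc := by
    have e₁ : ((π ⊗ₘ π) ⊗ₘ π) ≫ m ▷ T ≫ m = μ[Q] ▷ Q ≫ μ ≫ π := by
      rw [← h, ← tensorHom_id, ← tensorHom_id, tensorHom_comp_tensorHom_assoc,
        tensorHom_comp_tensorHom_assoc, h, Category.id_comp, Category.comp_id]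
    have e₂ : (π ⊗ₘ (π ⊗ₘ π)) ≫ T ◁ m ≫ m = Q ◁ μ[Q] ≫ μ ≫ π := by
      rw [← h, ← id_tensorHom, ← id_tensorHom, tensorHom_comp_tensorHom_assoc,
        tensorHom_comp_tensorHom_assoc, h, Category.id_comp, Category.comp_id]
    have : IsSplitEpi ((π ⊗ₘ π) ⊗ₘ π) := IsSplitEpi.mk'
      { section_ := (section_ π ⊗ₘ section_ π) ⊗ₘ section_ π, id := by simp }
    rw [← cancel_epi ((π ⊗ₘ π) ⊗ₘ π), e₁, associator_naturality_assoc, e₂, MonObj.mul_assoc_assoc]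

instance isSplitEpi_tensorHom {X Y X' Y' : C} (f : X ⟶ Y) (g : X' ⟶ Y') [IsSplitEpi f]
    [IsSplitEpi g] : IsSplitEpi (f ⊗ₘ g) :=
  IsSplitEpi.mk' { section_ := section_ f ⊗ₘ section_ g, id := by simp }

/-- A morphism which becomes a homomorphism after precomposing with a split epimorphic
homomorphism is a homomorphism. -/
lemma isMonHom_of_splitEpi {Q S T : C} [MonObj Q] [MonObj S] [MonObj T] (π : Q ⟶ S)
    [IsMonHom π] [IsSplitEpi π] (g : S ⟶ T) [h : IsMonHom (π ≫ g)] : IsMonHom g where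
  one_hom := by
    have := h.one_hom
    rwa [IsMonHom.one_hom_assoc] at this
  mul_hom := by
    have := h.mul_hom
    rw [IsMonHom.mul_hom_assoc, ← tensorHom_comp_tensorHom_assoc] at this
    rwa [cancel_epi] at this

variable [BraidedCategory C]

namespace CategoryTheory.CommMon

/-- The morphism of underlying objects of a homomorphism. -/
def base {S T : CommMon C} (f : S ⟶ T) : S.X ⟶ T.X := f.hom.hom

instance {S T : CommMon C} (f : S ⟶ T) : IsMonHom (base f) := f.hom.isMonHom_hom

/-- A homomorphism of commutative monoid objects from a morphism of the underlying objects. -/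
def ofBase {S T : CommMon C} (f : S.X ⟶ T.X) (h : IsMonHom f) : S ⟶ T :=
  CommMon.homMk { hom := f, isMonHom_hom := h }

@[simp] lemma base_ofBase {S T : CommMon C} (f : S.X ⟶ T.X) (h : IsMonHom f) :
    base (ofBase f h) = f := rfl

@[simp] lemma base_comp {R S T : CommMon C} (f : R ⟶ S) (g : S ⟶ T) :
    base (f ≫ g) = base f ≫ base g := rfl

@[simp] lemma base_id (S : CommMon C) : base (𝟙 S) = 𝟙 S.X := rfl

lemma base_ext {S T : CommMon C} {f g : S ⟶ T} (h : base f = base g) : f = g :=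
  CommMon.hom_ext _ _ h

end CategoryTheory.CommMon

/-- Splitting a linear idempotent of a commutative monoid object gives a commutative monoid
object. -/
lemma exists_split_commMon [IsIdempotentComplete C] (Q : CommMon C) (e : Q.X ⟶ Q.X)
    (he : e ≫ e = e) (hl : μ ≫ e = Q.X ◁ e ≫ μ) :
    ∃ (T : CommMon C) (π : Q ⟶ T) (s : T.X ⟶ Q.X), s ≫ CommMon.base π = 𝟙 T.X ∧
      CommMon.base π ≫ s = e ∧ (IsSeparableMon Q.X → IsSeparableMon T.X) := by
  have hr : μ ≫ e = e ▷ Q.X ≫ μ := by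
    rw [← IsCommMonObj.mul_comm Q.X, Category.assoc, hl,
      BraidedCategory.braiding_naturality_left_assoc]
  obtain ⟨T, s, π, h₁, h₂⟩ := IsIdempotentComplete.idempotents_split _ _ he
  have : IsSplitEpi π := IsSplitEpi.mk' { section_ := s, id := h₁ }
  have heπ : e ≫ π = π := by rw [← h₂, Category.assoc, h₁, Category.comp_id]
  -- By linearity on both sides the idempotents `e ⊗ e` move out through the product, where `π`
  -- absorbs them.
  have hm : (π ⊗ₘ π) ≫ (s ⊗ₘ s) ≫ μ ≫ π = μ ≫ π := by
    rw [tensorHom_comp_tensorHom_assoc, h₂, MonoidalCategory.tensorHom_def, Category.assoc,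
      ← reassoc_of% hl, ← reassoc_of% hr, heπ, heπ]
  let _ : MonObj T := splitMonObj π ((s ⊗ₘ s) ≫ μ ≫ π) hm
  have hμ : (π ⊗ₘ π) ≫ μ[T] = μ ≫ π := hm
  have : IsCommMonObj T := ⟨by
    rw [← cancel_epi (π ⊗ₘ π), BraidedCategory.braiding_naturality_assoc, hμ,
      IsCommMonObj.mul_comm_assoc]⟩
  have hπ : IsMonHom π := ⟨rfl, hμ.symm⟩
  refine ⟨⟨T⟩, CommMon.ofBase (T := ⟨T⟩) π hπ, s, h₁, h₂, fun ⟨σ, k₁, k₂, k₃⟩ => ?_⟩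
  change IsSeparableMon T
  -- Linearity makes `e` multiplication by the element `η ≫ e`; as `σ` is left linear, it then turns
  -- `e` into `e` acting on the left tensor factor.
  have he' : e = (λ_ _).inv ≫ (η ≫ e) ▷ Q.X ≫ μ := by
    rw [comp_whiskerRight_assoc, ← hr, MonObj.one_mul_assoc, Iso.inv_hom_id_assoc]
  have hσe : e ≫ σ = σ ≫ e ▷ Q.X := by
    rw [he', Category.assoc, Category.assoc, ← k₂, ← whisker_exchange_assoc,
      associator_inv_naturality_left_assoc, comp_whiskerRight, comp_whiskerRight,
      ← leftUnitor_inv_naturality_assoc]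
    simp
  have hz : e ≫ σ ≫ (π ⊗ₘ π) = σ ≫ (π ⊗ₘ π) := by
    rw [reassoc_of% hσe, ← tensorHom_id, tensorHom_comp_tensorHom, heπ, Category.id_comp]
  have hσ : (π ⊗ₘ π) ≫ μ[T] ≫ s ≫ σ ≫ (π ⊗ₘ π) = μ[Q.X] ≫ σ ≫ (π ⊗ₘ π) := by
    rw [reassoc_of% hμ, reassoc_of% h₂, hz]
  -- The section of `Q` pushed down to `T`. Its two linearity axioms are tested after the split
  -- epimorphism `π ⊗ π`, where `hσ` reduces them to those of `σ`.
  refine ⟨s ≫ σ ≫ (π ⊗ₘ π), ?_, ?_, ?_⟩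
  · rw [Category.assoc, Category.assoc, hμ, reassoc_of% k₁, h₁]
  · rw [← cancel_epi (π ⊗ₘ π), hσ, ← reassoc_of% k₂, ← id_tensorHom, tensorHom_comp_tensorHom_assoc,
      reassoc_of% h₂, hz, Category.comp_id, ← Category.id_comp π, ← tensorHom_comp_tensorHom_assoc,
      Category.id_comp, id_tensorHom, associator_inv_naturality_assoc, ← tensorHom_id,
      tensorHom_comp_tensorHom, hμ, Category.comp_id, ← tensorHom_id, tensorHom_comp_tensorHom,
      Category.id_comp]
  · rw [← cancel_epi (π ⊗ₘ π), hσ, ← reassoc_of% k₃, ← tensorHom_id, tensorHom_comp_tensorHom_assoc,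
      reassoc_of% h₂, hz, Category.comp_id, ← Category.id_comp π, ← tensorHom_comp_tensorHom_assoc,
      Category.id_comp, tensorHom_id, associator_naturality_assoc, ← id_tensorHom,
      tensorHom_comp_tensorHom, hμ, Category.comp_id, ← id_tensorHom, tensorHom_comp_tensorHom,
      Category.id_comp]

end SplitMon

/-! ### Relative tensor products over a separable ring. -/

section RelTensorObjects

open scoped MonObj
open RelTensor

variable {C : Type u} [Category.{v} C] [MonoidalCategory C]

section Algebra

variable {R S S' Q T : C} [MonObj R] [MonObj S] [MonObj S'] [MonObj Q] [MonObj T]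

/-- The module underlying an algebra `f : R ⟶ S`. -/
abbrev algMod (f : R ⟶ S) [IsMonHom f] : Mod C R :=
  mkMod S (f ▷ S ≫ μ)
    (by rw [← comp_whiskerRight_assoc, IsMonHom.one_hom, MonObj.one_mul])
    (by
      rw [← comp_whiskerRight_assoc, IsMonHom.mul_hom, comp_whiskerRight_assoc, MonObj.mul_assoc,
        MonoidalCategory.whiskerLeft_comp_assoc, MonoidalCategory.tensorHom_def']
      simp only [comp_whiskerRight, Category.assoc, associator_naturality_left_assoc,
        associator_naturality_middle_assoc, whisker_exchange_assoc])

/-- The canonical morphism `S ⊗ S' ⟶ Q` attached to two homomorphisms `S ⟶ Q` and `S' ⟶ Q`. -/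
abbrev mulPair (i : S ⟶ Q) (j : S' ⟶ Q) : S ⊗ S' ⟶ Q := (i ⊗ₘ j) ≫ μ[Q]

lemma mulPair_comp (i : S ⟶ Q) (j : S' ⟶ Q) (p : Q ⟶ T) [IsMonHom p] :
    mulPair i j ≫ p = mulPair (i ≫ p) (j ≫ p) := by
  simp [mulPair]

lemma inl_mulPair (i : S ⟶ Q) (j : S' ⟶ Q) [IsMonHom j] :
    (ρ_ S).inv ≫ S ◁ η[S'] ≫ mulPair i j = i := by
  rw [mulPair, MonoidalCategory.tensorHom_def', Category.assoc,
    ← MonoidalCategory.whiskerLeft_comp_assoc, IsMonHom.one_hom, whisker_exchange_assoc,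
    MonObj.mul_one]
  simp

lemma inr_mulPair (i : S ⟶ Q) (j : S' ⟶ Q) [IsMonHom i] :
    (λ_ S').inv ≫ η[S] ▷ S' ≫ mulPair i j = j := by
  rw [mulPair, MonoidalCategory.tensorHom_def, Category.assoc,
    ← comp_whiskerRight_assoc, IsMonHom.one_hom, ← whisker_exchange_assoc,
    MonObj.one_mul]
  simp

lemma mulPair_balanced {f : R ⟶ S} {f' : R ⟶ S'} {i : S ⟶ Q} {j : S' ⟶ Q} [IsMonHom i]
    [IsMonHom j] (h : f ≫ i = f' ≫ j) :
    (S ◁ f ≫ μ[S]) ▷ S' ≫ mulPair i j =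
      ((α_ S R S').hom ≫ S ◁ (f' ▷ S' ≫ μ[S'])) ≫ mulPair i j := by
  have e₁ : (S ◁ f ≫ μ[S]) ▷ S' ≫ mulPair i j =
      ((i ⊗ₘ (f ≫ i)) ⊗ₘ j) ≫ μ[Q] ▷ Q ≫ μ := by
    simp only [mulPair, ← id_tensorHom, ← tensorHom_id, tensorHom_comp_tensorHom_assoc,
      Category.assoc, IsMonHom.mul_hom, Category.id_comp, Category.comp_id]
  have e₂ : S ◁ (f' ▷ S' ≫ μ[S']) ≫ mulPair i j =
      (i ⊗ₘ ((f' ≫ j) ⊗ₘ j)) ≫ Q ◁ μ[Q] ≫ μ := by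
    simp only [mulPair, ← id_tensorHom, ← tensorHom_id, tensorHom_comp_tensorHom_assoc,
      Category.assoc, IsMonHom.mul_hom, Category.id_comp, Category.comp_id]
  rw [e₁, Category.assoc, e₂, h, MonObj.mul_assoc, associator_naturality_assoc]

/-- Inserting the units of `S` and `S'` on either side of `R` turns balancedness into commutativity
of the square; the converse is `mulPair_balanced`. -/
lemma eq_of_mulPair_balanced {f : R ⟶ S} {f' : R ⟶ S'} {i : S ⟶ Q} {j : S' ⟶ Q} [IsMonHom i]
    [IsMonHom j] (w : (S ◁ f ≫ μ[S]) ▷ S' ≫ mulPair i j =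
      ((α_ S R S').hom ≫ S ◁ (f' ▷ S' ≫ μ[S'])) ≫ mulPair i j) :
    f ≫ i = f' ≫ j := by
  have e : (λ_ R).inv ≫ η[S] ▷ R ≫ (ρ_ (S ⊗ R)).inv ≫ (S ⊗ R) ◁ η[S'] ≫
      (S ◁ f ≫ μ[S]) ▷ S' = f ≫ (ρ_ S).inv ≫ S ◁ η[S'] := by
    have e₀ : (λ_ R).inv ≫ η[S] ▷ R ≫ S ◁ f ≫ μ = f := by
      rw [← whisker_exchange_assoc, MonObj.one_mul]; simp
    rw [whisker_exchange, ← rightUnitor_inv_naturality_assoc, Category.assoc, reassoc_of% e₀]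
  have e' : (λ_ R).inv ≫ η[S] ▷ R ≫ (ρ_ (S ⊗ R)).inv ≫ (S ⊗ R) ◁ η[S'] ≫
      (α_ S R S').hom ≫ S ◁ (f' ▷ S' ≫ μ[S']) = f' ≫ (λ_ S').inv ≫ η[S] ▷ S' := by
    have e₀ : (ρ_ R).inv ≫ R ◁ η[S'] ≫ f' ▷ S' ≫ μ = f' := by
      rw [whisker_exchange_assoc, MonObj.mul_one]; simp
    have e₁ : (ρ_ (S ⊗ R)).inv ≫ (S ⊗ R) ◁ η[S'] ≫ (α_ S R S').hom ≫ S ◁ (f' ▷ S' ≫ μ[S']) =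
        S ◁ f' := by
      conv_rhs => rw [← e₀]
      simp
    rw [e₁, ← whisker_exchange, leftUnitor_inv_naturality_assoc]
  have h := congrArg (fun t => (λ_ R).inv ≫ η[S] ▷ R ≫ (ρ_ (S ⊗ R)).inv ≫ (S ⊗ R) ◁ η[S'] ≫ t) w
  simp only [Category.assoc] at h e'
  rw [reassoc_of% e, reassoc_of% e', inl_mulPair, inr_mulPair] at h
  exact h

/-- The unbundled form of `IsRelTensor`. -/
def IsRelTensorHom (f : R ⟶ S) (f' : R ⟶ S') (i : S ⟶ Q) (j : S' ⟶ Q) : Prop :=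
  ∃ w : (S ◁ f ≫ μ[S]) ▷ S' ≫ mulPair i j =
      ((α_ S R S').hom ≫ S ◁ (f' ▷ S' ≫ μ[S'])) ≫ mulPair i j,
    Nonempty (IsColimit (Cofork.ofπ (mulPair i j) w))

/-- The data `s`, `t` make a split coequalizer, an equational notion. This is what lets relative
tensor products pass through functors not assumed to preserve coequalizers. -/
lemma isRelTensorHom_of_split {f : R ⟶ S} {f' : R ⟶ S'} {i : S ⟶ Q} {j : S' ⟶ Q} [IsMonHom i]
    [IsMonHom j] (h : f ≫ i = f' ≫ j) (s : Q ⟶ S ⊗ S')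
    (t : S ⊗ S' ⟶ (S ⊗ R) ⊗ S') (hs : s ≫ mulPair i j = 𝟙 _)
    (ht : t ≫ (S ◁ f ≫ μ[S]) ▷ S' = mulPair i j ≫ s)
    (ht' : t ≫ (α_ S R S').hom ≫ S ◁ (f' ▷ S' ≫ μ[S']) = 𝟙 _) : IsRelTensorHom f f' i j :=
  ⟨mulPair_balanced h, ⟨(IsSplitCoequalizer.mk s t (mulPair_balanced h) hs ht' ht).isCoequalizer⟩⟩

end Algebra

lemma isRelTensor_iff [BraidedCategory C] {R S S' Q : CommMon C} (f : R ⟶ S) (f' : R ⟶ S')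
    (i : S ⟶ Q) (j : S' ⟶ Q) : IsRelTensor f f' i j ↔
      IsRelTensorHom (CommMon.base f) (CommMon.base f') (CommMon.base i) (CommMon.base j) :=
  Iff.rfl

variable [SymmetricCategory C]

section

variable {R S S' Q : C} [MonObj R] [MonObj S] [IsCommMonObj S] [MonObj S'] [IsCommMonObj S']
  [MonObj Q] (f : R ⟶ S) [IsMonHom f] (f' : R ⟶ S') [IsMonHom f'] {i : S ⟶ Q} {j : S' ⟶ Q}

lemma lact_algMod : lact (algMod f) = f ▷ S ≫ μ := rfl

lemma ract_algMod : ract (algMod f) = S ◁ f ≫ μ := by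
  change (β_ S R).hom ≫ f ▷ S ≫ μ = _
  rw [← BraidedCategory.braiding_naturality_right_assoc, IsCommMonObj.mul_comm]

lemma algMod_balanced {Z : C} (φ : S ⊗ S' ⟶ Z) :
    RelTensor.Balanced (algMod f) (algMod f') φ ↔ (S ◁ f ≫ μ[S]) ▷ S' ≫ φ =
      ((α_ S R S').hom ≫ S ◁ (f' ▷ S' ≫ μ[S'])) ≫ φ := by
  rw [RelTensor.Balanced, ract_algMod, lact_algMod, Category.assoc]

variable [IsCommMonObj R] [IsSeparableMon R]

/-- The idempotent of `S ⊗ S'` whose image is `S ⊗_R S'`. -/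
noncomputable def algIdem : S ⊗ S' ⟶ S ⊗ S' := relIdem (algMod f) (algMod f')

/-- A common splitting of the two actions of `R` on `S ⊗ S'`. -/
noncomputable def algSplit : S ⊗ S' ⟶ (S ⊗ R) ⊗ S' := relSplit (algMod f) (algMod f')

/-- Separability at work: `algSplit` inserts `σ(1) = ∑ r ⊗ r'` in the middle and lets `r'` act on
`S'`. Letting `r` act on `S` gives the idempotent; letting it act on `S'` instead gives the
identity, since `∑ r r' = 1`. -/
lemma algSplit_fst : algSplit f f' ≫ (S ◁ f ≫ μ[S]) ▷ S' = algIdem f f' := by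
  have e := relSplit_fst (algMod f) (algMod f')
  rwa [ract_algMod] at e

lemma algSplit_snd :
    algSplit f f' ≫ (α_ S R S').hom ≫ S ◁ (f' ▷ S' ≫ μ[S']) = 𝟙 (S ⊗ S') :=
  relSplit_snd (algMod f) (algMod f')

lemma algIdem_balanced : (S ◁ f ≫ μ[S]) ▷ S' ≫ algIdem f f' =
    ((α_ S R S').hom ≫ S ◁ (f' ▷ S' ≫ μ[S'])) ≫ algIdem f f' :=
  (algMod_balanced f f' _).1 (relIdem_balanced (algMod f) (algMod f'))

lemma algIdem_idem : algIdem f f' ≫ algIdem f f' = algIdem f f' :=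
  relIdem_idem (algMod f) (algMod f')

variable {f f'} in
lemma algIdem_absorb {Z : C} (φ : S ⊗ S' ⟶ Z) (h : (S ◁ f ≫ μ[S]) ▷ S' ≫ φ =
    ((α_ S R S').hom ≫ S ◁ (f' ▷ S' ≫ μ[S'])) ≫ φ) : algIdem f f' ≫ φ = φ :=
  relIdem_absorb _ _ _ ((algMod_balanced f f' _).2 h)

variable {f f'} in
/-- The relative tensor product over a separable ring is a direct summand of the absolute one. -/
lemma IsRelTensorHom.exists_section (h : IsRelTensorHom f f' i j) :
    ∃ s : Q ⟶ S ⊗ S', s ≫ mulPair i j = 𝟙 _ ∧ mulPair i j ≫ s = algIdem f f' := by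
  obtain ⟨w, ⟨hc⟩⟩ := h
  -- The idempotent is balanced, so it factors through the coequalizer.
  obtain ⟨s, hs⟩ : ∃ s : Q ⟶ S ⊗ S', mulPair i j ≫ s = algIdem f f' :=
    ⟨_, (Cofork.IsColimit.desc' hc _ (algIdem_balanced f f')).2⟩
  refine ⟨s, ?_, hs⟩
  apply Cofork.IsColimit.hom_ext hc
  change mulPair i j ≫ s ≫ mulPair i j = mulPair i j ≫ 𝟙 _
  rw [← Category.assoc, hs, Category.comp_id, algIdem_absorb _ w]

variable {f f'} in
open scoped Obj in
/-- A strong monoidal functor preserves relative tensor products over separable rings. -/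
lemma IsRelTensorHom.map {D : Type u'} [Category.{v'} D] [MonoidalCategory D]
    (F : C ⥤ D) [F.LaxMonoidal] [∀ X Y, IsIso (Functor.LaxMonoidal.μ F X Y)] [IsMonHom i]
    [IsMonHom j] (h : IsRelTensorHom f f' i j) :
    IsRelTensorHom (F.map f) (F.map f') (F.map i) (F.map j) := by
  obtain ⟨s, hs, hs'⟩ := h.exists_section
  have hρ : mulPair (F.map i) (F.map j) = Functor.LaxMonoidal.μ F _ _ ≫ F.map (mulPair i j) := by
    simp [mulPair, Functor.obj.μ_def]
  -- The new splitting consists of the images of `s` and `algSplit f f'`, corrected by the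
  -- comparison isomorphisms of `F`.
  refine isRelTensorHom_of_split ?_ (F.map s ≫ inv (Functor.LaxMonoidal.μ F _ _))
    (Functor.LaxMonoidal.μ F _ _ ≫ F.map (algSplit f f') ≫
      inv (Functor.LaxMonoidal.μ F (S ⊗ R) S') ≫ inv (Functor.LaxMonoidal.μ F S R) ▷ F.obj S')
    ?_ ?_ ?_
  · rw [← F.map_comp, ← F.map_comp, eq_of_mulPair_balanced h.choose]
  · rw [hρ, Category.assoc, IsIso.inv_hom_id_assoc, ← F.map_comp, hs, F.map_id]
  · have k : (F.obj S ◁ F.map f ≫ μ[F.obj S]) ▷ F.obj S' = Functor.LaxMonoidal.μ F _ _ ▷ _ ≫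
        F.map (S ◁ f ≫ μ[S]) ▷ F.obj S' := by
      simp [Functor.obj.μ_def]
    have k' : F.map (S ◁ f ≫ μ[S]) ▷ F.obj S' = Functor.LaxMonoidal.μ F _ _ ≫
        F.map ((S ◁ f ≫ μ[S]) ▷ S') ≫ inv (Functor.LaxMonoidal.μ F _ _) := by
      rw [← Functor.LaxMonoidal.μ_natural_left_assoc, IsIso.hom_inv_id, Category.comp_id]
    rw [hρ, Category.assoc (Functor.LaxMonoidal.μ F S S') (F.map (mulPair i j)),
      ← F.map_comp_assoc, hs', ← algSplit_fst, F.map_comp_assoc, k, k']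
    simp only [Category.assoc]
    rw [← comp_whiskerRight_assoc, IsIso.inv_hom_id, id_whiskerRight, Category.id_comp,
      IsIso.inv_hom_id_assoc]
  · have k : F.obj S ◁ (F.map f' ▷ F.obj S' ≫ μ[F.obj S']) =
        F.obj S ◁ Functor.LaxMonoidal.μ F _ _ ≫ F.obj S ◁ F.map (f' ▷ S' ≫ μ[S']) := by
      simp [Functor.obj.μ_def]
    have k' : F.obj S ◁ F.map (f' ▷ S' ≫ μ[S']) = Functor.LaxMonoidal.μ F _ _ ≫
        F.map (S ◁ (f' ▷ S' ≫ μ[S'])) ≫ inv (Functor.LaxMonoidal.μ F _ _) := by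
      rw [← Functor.LaxMonoidal.μ_natural_right_assoc, IsIso.hom_inv_id, Category.comp_id]
    have e := congrArg F.map (algSplit_snd f f')
    rw [F.map_comp, F.map_comp, F.map_id] at e
    rw [k, k']
    simp only [Category.assoc]
    rw [← Functor.LaxMonoidal.associativity_assoc, ← comp_whiskerRight_assoc, IsIso.inv_hom_id,
      id_whiskerRight, Category.id_comp, IsIso.inv_hom_id_assoc, reassoc_of% e,
      IsIso.hom_inv_id]

end

end RelTensorObjects

/-! ### Products of rings as biproducts. -/

section RingProducts

variable {C : Type u} [Category.{v} C] [MonoidalCategory C] [BraidedCategory C] [Preadditive C]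

open CommMon

/-- In a preadditive category a binary product is a biproduct; the equations on the right are
preserved by every additive functor and can be checked by hand. -/
lemma isRingProduct_iff {Q S T : CommMon C} (p : Q ⟶ S) (q : Q ⟶ T) :
    IsRingProduct p q ↔ ∃ (a : S.X ⟶ Q.X) (b : T.X ⟶ Q.X), a ≫ base p = 𝟙 _ ∧
      b ≫ base q = 𝟙 _ ∧ a ≫ base q = 0 ∧ b ≫ base p = 0 ∧
      base p ≫ a + base q ≫ b = 𝟙 _ := by
  change Nonempty (IsLimit (BinaryFan.mk (base p) (base q))) ↔ _
  generalize base p = p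
  generalize base q = q
  constructor
  · rintro ⟨h⟩
    obtain ⟨a, ha₁, ha₂⟩ : ∃ a : S.X ⟶ Q.X, a ≫ p = 𝟙 S.X ∧ a ≫ q = 0 :=
      ⟨_, (BinaryFan.IsLimit.lift' h (𝟙 S.X) 0).2⟩
    obtain ⟨b, hb₁, hb₂⟩ : ∃ b : T.X ⟶ Q.X, b ≫ p = 0 ∧ b ≫ q = 𝟙 T.X :=
      ⟨_, (BinaryFan.IsLimit.lift' h 0 (𝟙 T.X)).2⟩
    refine ⟨a, b, ha₁, hb₂, ha₂, hb₁, ?_⟩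
    apply BinaryFan.IsLimit.hom_ext h
    · change (p ≫ a + q ≫ b) ≫ p = 𝟙 _ ≫ p
      rw [Preadditive.add_comp, Category.assoc, Category.assoc, ha₁, hb₁]
      simp
    · change (p ≫ a + q ≫ b) ≫ q = 𝟙 _ ≫ q
      rw [Preadditive.add_comp, Category.assoc, Category.assoc, ha₂, hb₂]
      simp
  · rintro ⟨a, b, h₁, h₂, h₃, h₄, h₅⟩
    refine ⟨BinaryFan.IsLimit.mk _ (fun u v => u ≫ a + v ≫ b) (fun u v => by simp [h₁, h₄])
      (fun u v => by simp [h₂, h₃]) (fun u v m hu hv => ?_)⟩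
    subst hu hv
    simpa using congrArg (fun t => m ≫ t) h₅.symm

end RingProducts

/-! ### The splitting theorem: constructing the next stage. -/

section SplittingStep

open scoped MonObj
open RelTensor CommMon

variable {C : Type u} [Category.{v} C] [MonoidalCategory C]

section Inclusions

variable [BraidedCategory C] (S S' : C) [MonObj S] [MonObj S']

lemma isMonHom_one : IsMonHom η[S] where
  one_hom := Category.id_comp _
  mul_hom := by
    change (λ_ (𝟙_ C)).hom ≫ η = _
    rw [MonoidalCategory.tensorHom_def', Category.assoc, MonObj.one_mul, leftUnitor_naturality]

lemma isMonHom_mul [IsCommMonObj S] : IsMonHom μ[S] where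
  one_hom := by
    rw [MonObj.tensorObj.one_def, Category.assoc, MonoidalCategory.tensorHom_def', Category.assoc,
      MonObj.one_mul, leftUnitor_naturality, Iso.inv_hom_id_assoc]
  mul_hom := by
    rw [MonObj.tensorObj.mul_def, Category.assoc, MonObj.mul_mul_mul_comm]

/-- The inclusion of the left factor of a tensor product of monoid objects. -/
def tensorInl : S ⟶ S ⊗ S' := (ρ_ S).inv ≫ S ◁ η[S']

/-- The inclusion of the right factor of a tensor product of monoid objects. -/
def tensorInr : S' ⟶ S ⊗ S' := (λ_ S').inv ≫ η[S] ▷ S'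

instance : IsMonHom (tensorInl S S') := by
  have := isMonHom_one S'
  unfold tensorInl
  infer_instance

instance : IsMonHom (tensorInr S S') := by
  have := isMonHom_one S
  unfold tensorInr
  infer_instance

/-- This is `(s ⊗ 1)(1 ⊗ s') = s ⊗ s'`: the braiding only moves units past each other. It shows that
a ring map out of `S ⊗ S'` is `mulPair` of its two restrictions. -/
lemma mulPair_tensorInl_tensorInr : mulPair (tensorInl S S') (tensorInr S S') = 𝟙 (S ⊗ S') := by
  have h := tensorμ_natural (𝟙 S) η[S'] η[S] (𝟙 S')
  rw [mulPair, tensorInl, tensorInr, ← tensorHom_comp_tensorHom, MonObj.tensorObj.mul_def,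
    ← id_tensorHom, ← tensorHom_id, Category.assoc, reassoc_of% h, tensorHom_comp_tensorHom,
    id_tensorHom, tensorHom_id, MonObj.mul_one, MonObj.one_mul]
  rw [tensorμ, braiding_tensorUnit_left]
  monoidal

end Inclusions

section Linear

variable [BraidedCategory C] {Q : C} [MonObj Q] [IsCommMonObj Q]

/-- Multiplication by an element of a monoid object. -/
def mulBy (τ : 𝟙_ C ⟶ Q) : Q ⟶ Q := (λ_ Q).inv ≫ τ ▷ Q ≫ μ

lemma mulBy_linear_right (τ : 𝟙_ C ⟶ Q) : μ ≫ mulBy τ = mulBy τ ▷ Q ≫ μ := by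
  simp only [mulBy, comp_whiskerRight, Category.assoc, MonObj.mul_assoc,
    leftUnitor_inv_naturality_assoc, whisker_exchange_assoc]
  simp

lemma mulBy_linear (τ : 𝟙_ C ⟶ Q) : μ ≫ mulBy τ = Q ◁ mulBy τ ≫ μ := by
  conv_lhs => rw [← IsCommMonObj.mul_comm Q, Category.assoc, mulBy_linear_right,
      ← BraidedCategory.braiding_naturality_right_assoc, IsCommMonObj.mul_comm]

end Linear

variable [SymmetricCategory C]

/-- Swapping the first two factors after `tensorμ` amounts to moving `A'` across all of `A ⊗ B` at
once: a hexagon identity. -/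
lemma tensorμ_braiding (A B A' B' : C) : tensorμ A B A' B' ≫ (β_ A A').hom ▷ (B ⊗ B') =
    (α_ (A ⊗ B) A' B').inv ≫ (β_ (A ⊗ B) A').hom ▷ B' ≫ (α_ A' (A ⊗ B) B').hom ≫
      A' ◁ (α_ A B B').hom ≫ (α_ A' A (B ⊗ B')).inv := by
  simp only [tensorμ, BraidedCategory.braiding_tensor_left_hom]
  monoidal

/-- For `τ = ∑ t ⊗ t'`, commutativity of `S` lets multiplication by `τ` be written `s ⊗ s' ↦ ∑ st ⊗
t's'`, the shape in which `algIdem` is defined. -/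
lemma mulBy_tensor (S S' : C) [MonObj S] [MonObj S'] [IsCommMonObj S] (τ : 𝟙_ C ⟶ S ⊗ S') :
    mulBy τ = S ◁ ((λ_ S').inv ≫ τ ▷ S' ≫ (α_ S S' S').hom) ≫ (α_ S S (S' ⊗ S')).inv ≫
      (μ ⊗ₘ μ) := by
  have h : tensorμ S S' S S' ≫ (μ[S] ⊗ₘ μ[S']) =
      (tensorμ S S' S S' ≫ (β_ S S).hom ▷ (S' ⊗ S')) ≫ (μ[S] ⊗ₘ μ[S']) := by
    rw [MonoidalCategory.tensorHom_def, Category.assoc, ← comp_whiskerRight_assoc,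
      IsCommMonObj.mul_comm]
  rw [mulBy, MonObj.tensorObj.mul_def, h, tensorμ_braiding]
  simp only [Category.assoc]
  rw [associator_inv_naturality_left_assoc, ← comp_whiskerRight_assoc (τ ▷ S),
    BraidedCategory.braiding_naturality_left, braiding_tensorUnit_left]
  simp only [← Category.assoc]
  congr 1
  monoidal

section

variable {R S S' : C} [MonObj R] [IsCommMonObj R] [IsSeparableMon R] [MonObj S] [IsCommMonObj S]
  [MonObj S'] [IsCommMonObj S'] (f : R ⟶ S) [IsMonHom f] (f' : R ⟶ S') [IsMonHom f']

/-- The idempotent is multiplication by the image of the separability element `σ(1)`. Hence it is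
linear over `S ⊗ S'`, and its image inherits a ring structure. -/
lemma algIdem_eq_mulBy : algIdem f f' = mulBy ((η[R] ≫ sec R) ≫ (f ⊗ₘ f')) := by
  have e : algIdem f f' = S ◁ (λ_ S').inv ≫ S ◁ ((η[R] ≫ sec R) ▷ S' ≫ (α_ R R S').hom) ≫
      (α_ S R (R ⊗ S')).inv ≫ ((S ◁ f ≫ μ[S]) ⊗ₘ (f' ▷ S' ≫ μ[S'])) := by
    rw [← ract_algMod]
    rfl
  have k : (f ⊗ₘ f') ▷ S' ≫ (α_ S S' S').hom = (α_ R R S').hom ≫ (f ⊗ₘ (f' ▷ S')) := by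
    rw [← tensorHom_id, associator_naturality, tensorHom_id]
  have k' : S ◁ (f ⊗ₘ (f' ▷ S')) ≫ (α_ S S (S' ⊗ S')).inv =
      (α_ S R (R ⊗ S')).inv ≫ ((S ◁ f) ⊗ₘ (f' ▷ S')) := by
    rw [← id_tensorHom, associator_inv_naturality, id_tensorHom]
  rw [e, mulBy_tensor, ← tensorHom_comp_tensorHom, comp_whiskerRight _ (f ⊗ₘ f'), Category.assoc, k]
  simp only [MonoidalCategory.whiskerLeft_comp, Category.assoc, reassoc_of% k']

lemma algIdem_linear : μ ≫ algIdem f f' = (S ⊗ S') ◁ algIdem f f' ≫ μ := by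
  rw [algIdem_eq_mulBy, mulBy_linear]

/-- Since `R ⊗_R R = R`, the projector is multiplication followed by its section. Its role is to
make `μ ≫ sec R` linear over `R ⊗ R` by way of `algIdem_linear`. -/
lemma algIdem_self : algIdem (𝟙 R) (𝟙 R) = μ ≫ sec R := by
  -- A balanced `φ` satisfies `φ(a ⊗ b) = φ(ab ⊗ 1)`, so only the values on `a ⊗ 1` matter; there
  -- `k` and `k'` compute `a σ(1) = σ(a)`.
  have hb {Z : C} (φ : R ⊗ R ⟶ Z) (h : (R ◁ 𝟙 R ≫ μ[R]) ▷ R ≫ φ =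
      ((α_ R R R).hom ≫ R ◁ (𝟙 R ▷ R ≫ μ[R])) ≫ φ) : φ = μ ≫ (ρ_ R).inv ≫ R ◁ η[R] ≫ φ := by
    simp only [MonoidalCategory.whiskerLeft_id, id_whiskerRight, Category.id_comp,
      Category.assoc] at h
    rw [rightUnitor_inv_naturality_assoc, ← whisker_exchange_assoc, h,
      associator_naturality_right_assoc, ← MonoidalCategory.whiskerLeft_comp_assoc, MonObj.mul_one]
    simp
  have k : η ≫ (λ_ R).inv ≫ (η ≫ sec R) ▷ R ≫ (α_ R R R).hom ≫ R ◁ μ = η ≫ sec R := by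
    rw [leftUnitor_inv_naturality_assoc, whisker_exchange_assoc, associator_naturality_right_assoc,
      ← MonoidalCategory.whiskerLeft_comp, MonObj.mul_one]
    simp [unitors_inv_equal]
  have k' : R ◁ (η ≫ sec R) ≫ (α_ R R R).inv ≫ μ ▷ R = (ρ_ R).hom ≫ sec R := by
    rw [MonoidalCategory.whiskerLeft_comp_assoc, sec_left, MonObj.mul_one_assoc]
  rw [hb _ (algIdem_balanced (𝟙 R) (𝟙 R)), algIdem_eq_mulBy, mulBy_tensor, id_tensorHom_id,
    Category.comp_id, MonoidalCategory.tensorHom_def',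
    ← associator_inv_naturality_right_assoc, ← MonoidalCategory.whiskerLeft_comp_assoc,
    ← MonoidalCategory.whiskerLeft_comp_assoc]
  simp only [Category.assoc, k, k', Iso.inv_hom_id_assoc]

end

/-- The multiplication of `S` is `R`-balanced, so the idempotent does not change it and it descends
to `S ⊗_R S ⟶ S`. -/
lemma algIdem_comp_mul {R S : C} [MonObj R] [IsCommMonObj R] [IsSeparableMon R] [MonObj S]
    [IsCommMonObj S] (f : R ⟶ S) [IsMonHom f] : algIdem f f ≫ μ = μ[S] := by
  apply algIdem_absorb
  have h := mulPair_balanced (f := f) (f' := f) (i := 𝟙 S) (j := 𝟙 S) rfl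
  simpa only [mulPair, id_tensorHom_id, Category.id_comp] using h

variable [IsIdempotentComplete C]

/-- Relative tensor products over separable rings exist. -/
lemma exists_relTensor {R S S' : CommMon C} [IsSeparableMon R.X] (f : R ⟶ S) (f' : R ⟶ S') :
    ∃ (Q : CommMon C) (i : S ⟶ Q) (j : S' ⟶ Q) (s : Q.X ⟶ S.X ⊗ S'.X),
      IsRelTensor f f' i j ∧ s ≫ mulPair (base i) (base j) = 𝟙 _ ∧
      mulPair (base i) (base j) ≫ s = algIdem (base f) (base f') ∧
      IsMonHom (mulPair (base i) (base j)) ∧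
      (IsSeparableMon S.X → IsSeparableMon S'.X → IsSeparableMon Q.X) := by
  obtain ⟨Q, π, s, h₁, h₂, h₃⟩ := exists_split_commMon ⟨S.X ⊗ S'.X⟩
    (algIdem (base f) (base f')) (algIdem_idem _ _) (algIdem_linear _ _)
  have hπ : IsMonHom (base π) := inferInstance
  generalize base π = π at h₁ h₂ hπ
  change S.X ⊗ S'.X ⟶ Q.X at π
  have hl : IsMonHom (tensorInl S.X S'.X ≫ π) := inferInstance
  have hr : IsMonHom (tensorInr S.X S'.X ≫ π) := inferInstance
  have e : mulPair (tensorInl S.X S'.X ≫ π) (tensorInr S.X S'.X ≫ π) = π := by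
    rw [← mulPair_comp, mulPair_tensorInl_tensorInr, Category.id_comp]
  have hb : algIdem (base f) (base f') ≫ π = π := by
    rw [← h₂, Category.assoc, h₁, Category.comp_id]
  refine ⟨Q, ofBase (tensorInl S.X S'.X ≫ π) hl, ofBase (tensorInr S.X S'.X ≫ π) hr, s, ?_, ?_, ?_,
    ?_, fun _ _ => h₃ inferInstance⟩
  · rw [isRelTensor_iff]
    -- The two maps from `R` to `Q` agree because `π` inherits balancedness from the idempotent it
    -- absorbs.
    refine isRelTensorHom_of_split (eq_of_mulPair_balanced ?_) s
      (algSplit (base f) (base f')) ?_ ?_ (algSplit_snd _ _)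
    · simp only [base_ofBase, e]
      rw [← hb, ← Category.assoc, algIdem_balanced, Category.assoc]
    · simpa only [base_ofBase, e] using h₁
    · simpa only [base_ofBase, e, h₂] using algSplit_fst (base f) (base f')
  · simpa only [base_ofBase, e] using h₁
  · simpa only [base_ofBase, e] using h₂
  · simpa only [base_ofBase, e] using hπ

variable [Preadditive C] [MonoidalPreadditive C]

/-- The splitting theorem: the next stage of the splitting tower. -/
lemma exists_splittingStep {R S : CommMon C} [IsSeparableMon R.X] [IsSeparableMon S.X]
    (f : R ⟶ S) : ∃ (T : CommMon C) (g : S ⟶ T), IsSplittingStep f g ∧ IsSeparableMon T.X := by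
  obtain ⟨Q, i, j, s, hQ, h₁, h₂, hπ, hsep⟩ := exists_relTensor f f
  have := hsep inferInstance inferInstance
  set π := mulPair (base i) (base j) with hπdef
  have : IsSplitEpi π := IsSplitEpi.mk' { section_ := s, id := h₁ }
  have hμ : IsMonHom μ[S.X] := isMonHom_mul S.X
  have hπp : π ≫ s ≫ μ[S.X] = μ[S.X] := by
    rw [reassoc_of% h₂, algIdem_comp_mul]
  -- The descended multiplication is a ring map because it becomes one, namely `μ`, after the split
  -- epimorphism `π`.
  have hp : IsMonHom (s ≫ μ[S.X]) := by
    have : IsMonHom (π ≫ s ≫ μ[S.X]) := by rwa [hπp]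
    exact isMonHom_of_splitEpi π _
  set p := s ≫ μ[S.X] with hpdef
  -- The separability section of `S`, projected to `S ⊗_R S`, is a section of `p`.
  set a := sec S.X ≫ π with hadef
  have hap : a ≫ p = 𝟙 _ := by
    rw [hadef, Category.assoc, hπp, sec_mul]
  -- Linearity over `Q` is checked on `S ⊗ S`, where it is linearity of `μ ≫ sec S.X`, the
  -- idempotent of `S` over itself.
  have hlin : μ[Q.X] ≫ p ≫ a = Q.X ◁ (p ≫ a) ≫ μ[Q.X] := by
    have hl := algIdem_linear (𝟙 S.X) (𝟙 S.X)
    rw [algIdem_self] at hl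
    rw [← cancel_epi (π ⊗ₘ π), ← id_tensorHom, ← IsMonHom.mul_hom_assoc, reassoc_of% hπp,
      tensorHom_comp_tensorHom_assoc, Category.comp_id, reassoc_of% hπp, hadef, reassoc_of% hl,
      IsMonHom.mul_hom (f := π), ← id_tensorHom, tensorHom_comp_tensorHom_assoc, Category.id_comp,
      Category.assoc]
  -- The new stage is the image of the complementary idempotent, again linear and so again a
  -- separable ring.
  obtain ⟨T, q, b, hb₁, hb₂, hT⟩ := exists_split_commMon Q (𝟙 _ - p ≫ a)
    (by simp [reassoc_of% hap])
    (by
      have h : Q.X ◁ (𝟙 Q.X - p ≫ a) = Q.X ◁ 𝟙 Q.X - Q.X ◁ (p ≫ a) :=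
        (tensorLeft Q.X).map_sub
      rw [h, Preadditive.comp_sub, Preadditive.sub_comp, hlin]
      simp)
  have hbe : b ≫ (𝟙 _ - p ≫ a) = b := by rw [← hb₂, ← Category.assoc, hb₁, Category.id_comp]
  have heq : (𝟙 _ - p ≫ a) ≫ base q = base q := by
    rw [← hb₂, Category.assoc, hb₁, Category.comp_id]
  have hunit : base i ≫ p = 𝟙 _ ∧ base j ≫ p = 𝟙 _ := by
    constructor
    · rw [← inl_mulPair (base i) (base j)]
      simp only [Category.assoc, ← hπdef, hπp]
      rw [MonObj.mul_one, Iso.inv_hom_id]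
    · rw [← inr_mulPair (base i) (base j)]
      simp only [Category.assoc, ← hπdef, hπp]
      rw [MonObj.one_mul, Iso.inv_hom_id]
  refine ⟨T, i ≫ q, ⟨Q, i, j, ofBase p hp, q, hQ, ?_, base_ext hunit.1, base_ext hunit.2, rfl⟩,
    hT inferInstance⟩
  rw [isRingProduct_iff]
  refine ⟨a, b, hap, hb₁, ?_, ?_, ?_⟩
  · rw [← heq]
    simp [reassoc_of% hap]
  · rw [← hbe]
    simp [hap]
  · rw [hb₂, base_ofBase]
    simp

end SplittingStep

/-! ### Splitting towers: existence. -/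

section Towers

open scoped MonObj
open RelTensor CommMon

variable {C : Type u} [Category.{v} C] [MonoidalCategory C]

instance isSeparableMon_unit : IsSeparableMon (𝟙_ C) where
  exists_section := ⟨(λ_ _).inv, by
    change (λ_ (𝟙_ C)).inv ≫ (λ_ _).hom = 𝟙 _
    simp, by
    change 𝟙_ C ◁ (λ_ (𝟙_ C)).inv ≫ (α_ _ _ _).inv ≫ (λ_ _).hom ▷ _ = (λ_ _).hom ≫ (λ_ _).inv
    monoidal, by
    change (λ_ (𝟙_ C)).inv ▷ _ ≫ (α_ _ _ _).hom ≫ _ ◁ (λ_ _).hom = (λ_ _).hom ≫ (λ_ _).inv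
    monoidal⟩

section Existence

variable [SymmetricCategory C]

variable (C) in
/-- Two consecutive stages of a splitting tower. -/
structure TowerStage where
  /-- The earlier stage. -/
  src : CommMon C
  /-- The later stage. -/
  tgt : CommMon C
  /-- The transition homomorphism. -/
  hom : src ⟶ tgt
  separable_src : IsSeparableMon src.X
  separable_tgt : IsSeparableMon tgt.X

variable [IsIdempotentComplete C] [Preadditive C] [MonoidalPreadditive C]

lemma TowerStage.exists_next (s : TowerStage C) : ∃ (T : CommMon C) (g : s.tgt ⟶ T),
    IsSplittingStep s.hom g ∧ IsSeparableMon T.X :=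
  have := s.separable_src
  have := s.separable_tgt
  exists_splittingStep s.hom

/-- The next two consecutive stages. -/
noncomputable def TowerStage.next (s : TowerStage C) : TowerStage C where
  src := s.tgt
  tgt := s.exists_next.choose
  hom := s.exists_next.choose_spec.choose
  separable_src := s.separable_tgt
  separable_tgt := s.exists_next.choose_spec.choose_spec.2

/-- The stages obtained by iterating the splitting theorem. -/
noncomputable def TowerStage.iterate (s : TowerStage C) : ℕ → TowerStage C
  | 0 => s
  | n + 1 => (s.iterate n).next

/-- Splitting towers exist. -/
lemma nonempty_splittingTower (A : CommMon C) [IsSeparableMon A.X] :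
    Nonempty (SplittingTower A) :=
  let s : TowerStage C :=
    { src := CommMon.trivial C
      tgt := A
      -- The trivial ring is initial among commutative rings; this is the unit of `A`.
      hom := default
      separable_src := isSeparableMon_unit
      separable_tgt := inferInstance }
  ⟨{  obj := fun n => (s.iterate n).src
      separable := fun n => (s.iterate n).separable_src
      map := fun n => (s.iterate n).hom
      isoZero := Iso.refl _
      isoOne := Iso.refl _
      step := fun n => (s.iterate n).exists_next.choose_spec.choose_spec.1 }⟩

end Existence

/-! ### Splitting towers: uniqueness. -/

section Uniqueness

section Pushout

variable [SymmetricCategory C] {R S S' Q T : CommMon C} [IsSeparableMon R.X] {f : R ⟶ S}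
  {f' : R ⟶ S'} {i : S ⟶ Q} {j : S' ⟶ Q}

lemma isMonHom_mulPair (i : S ⟶ Q) (j : S' ⟶ Q) : IsMonHom (mulPair (base i) (base j)) :=
  have := isMonHom_mul Q.X
  inferInstance

lemma IsRelTensor.isSplitEpi (h : IsRelTensor f f' i j) :
    IsSplitEpi (mulPair (base i) (base j)) :=
  let ⟨s, hs, _⟩ := IsRelTensorHom.exists_section ((isRelTensor_iff f f' i j).1 h)
  IsSplitEpi.mk' { section_ := s, id := hs }

lemma IsRelTensor.condition (h : IsRelTensor f f' i j) : f ≫ i = f' ≫ j :=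
  base_ext (eq_of_mulPair_balanced (f := base f) (f' := base f') (i := base i) (j := base j)
    h.choose)

lemma IsRelTensor.hom_ext (h : IsRelTensor f f' i j) {u v : Q ⟶ T} (hi : i ≫ u = i ≫ v)
    (hj : j ≫ u = j ≫ v) : u = v := by
  have := h.isSplitEpi
  apply base_ext
  rw [← cancel_epi (mulPair (base i) (base j)), mulPair_comp, mulPair_comp, ← base_comp, hi,
    ← base_comp, hj, base_comp, base_comp]

/-- The relative tensor product is the pushout of commutative ring objects. -/
lemma IsRelTensor.exists_desc (h : IsRelTensor f f' i j) (u : S ⟶ T) (v : S' ⟶ T)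
    (w : f ≫ u = f' ≫ v) : ∃ t : Q ⟶ T, i ≫ t = u ∧ j ≫ t = v := by
  have := h.isSplitEpi
  obtain ⟨s, hs₁, hs₂⟩ := IsRelTensorHom.exists_section ((isRelTensor_iff f f' i j).1 h)
  -- The commuting square makes the map induced by `u` and `v` balanced, so it is unchanged by the
  -- projector onto `Q` and descends.
  have e : mulPair (base i) (base j) ≫ s ≫ mulPair (base u) (base v) =
      mulPair (base u) (base v) := by
    rw [← Category.assoc, hs₂]
    exact algIdem_absorb _ (mulPair_balanced (congrArg base w))
  have ht : IsMonHom (s ≫ mulPair (base u) (base v)) := by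
    have := isMonHom_mulPair i j
    have : IsMonHom (mulPair (base i) (base j) ≫ s ≫ mulPair (base u) (base v)) := by
      rw [e]
      exact isMonHom_mulPair u v
    exact isMonHom_of_splitEpi (mulPair (base i) (base j)) _
  refine ⟨ofBase _ ht, base_ext ?_, base_ext ?_⟩
  · rw [base_comp, base_ofBase, ← inl_mulPair (base i) (base j)]
    simp only [mulPair, Category.assoc] at e ⊢
    rw [e]
    exact inl_mulPair _ _
  · rw [base_comp, base_ofBase, ← inr_mulPair (base i) (base j)]
    simp only [mulPair, Category.assoc] at e ⊢
    rw [e]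
    exact inr_mulPair _ _

end Pushout

section Products

variable [BraidedCategory C] [Preadditive C] [MonoidalPreadditive C]

/-- In `Q`, the product `a(s) b'(1)` vanishes: `p` kills `b'(1)`, `q` kills `a(s)`, and `p`, `q` are
jointly faithful by `h`. Applying `q'`, which sends `b'(1)` to `1`, gives `q'(a(s)) = 0`. So the
copy of `S` inside `Q` depends only on `p`. -/
lemma section_comp_eq_zero {S Q T T' : C} [MonObj S] [MonObj Q] [MonObj T] [MonObj T']
    {p : Q ⟶ S} {q : Q ⟶ T} {q' : Q ⟶ T'} [IsMonHom p] [IsMonHom q] [IsMonHom q']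
    {a : S ⟶ Q} {b : T ⟶ Q} {b' : T' ⟶ Q} (haq : a ≫ q = 0) (h : p ≫ a + q ≫ b = 𝟙 _)
    (hbq : b' ≫ q' = 𝟙 _) (hbp : b' ≫ p = 0) : a ≫ q' = 0 := by
  have e : S ◁ (η[T'] ≫ b') ≫ a ▷ Q ≫ μ = 0 := by
    have e₁ : (S ◁ (η[T'] ≫ b') ≫ a ▷ Q ≫ μ) ≫ p = 0 := by
      simp only [Category.assoc, IsMonHom.mul_hom, MonoidalCategory.tensorHom_def]
      rw [← whisker_exchange_assoc p, ← whisker_exchange_assoc a]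
      rw [← MonoidalCategory.whiskerLeft_comp_assoc, Category.assoc, hbp]
      simp
    have e₂ : (S ◁ (η[T'] ≫ b') ≫ a ▷ Q ≫ μ) ≫ q = 0 := by
      simp only [Category.assoc, IsMonHom.mul_hom, MonoidalCategory.tensorHom_def]
      rw [← comp_whiskerRight_assoc, haq]
      simp
    rw [← Category.comp_id (S ◁ (η[T'] ≫ b') ≫ a ▷ Q ≫ μ), ← h, Preadditive.comp_add,
      ← Category.assoc _ p, e₁, ← Category.assoc _ q, e₂]
    simp
  have e' := e =≫ q'
  simp only [Category.assoc, IsMonHom.mul_hom, MonoidalCategory.tensorHom_def', zero_comp] at e'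
  rw [← whisker_exchange_assoc a, ← MonoidalCategory.whiskerLeft_comp_assoc, Category.assoc, hbq,
    Category.comp_id, ← comp_whiskerRight_assoc, whisker_exchange_assoc, MonObj.mul_one,
    rightUnitor_naturality] at e'
  exact (cancel_epi (ρ_ S).hom).1 (e'.trans comp_zero.symm)

/-- The second factor is determined by the first projection: since `q'` vanishes on the first factor
and `q` on the first factor of the other decomposition, `b ≫ q'` and `b' ≫ q` are inverse to each
other. -/
lemma IsRingProduct.exists_iso {S Q T T' : CommMon C} {p : Q ⟶ S} {q : Q ⟶ T} {q' : Q ⟶ T'}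
    (h : IsRingProduct p q) (h' : IsRingProduct p q') : ∃ t : T ≅ T', q ≫ t.hom = q' := by
  obtain ⟨a, b, h₁, h₂, h₃, h₄, h₅⟩ := (isRingProduct_iff p q).1 h
  obtain ⟨a', b', h₁', h₂', h₃', h₄', h₅'⟩ := (isRingProduct_iff p q').1 h'
  have z := section_comp_eq_zero h₃ h₅ h₂' h₄'
  have z' := section_comp_eq_zero h₃' h₅' h₂ h₄
  have e : base q ≫ b ≫ base q' = base q' := by
    simpa [z] using congrArg (fun t => t ≫ base q') h₅
  have e' : base q' ≫ b' ≫ base q = base q := by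
    simpa [z'] using congrArg (fun t => t ≫ base q) h₅'
  have i₁ : IsSplitEpi (base q) := IsSplitEpi.mk' { section_ := b, id := h₂ }
  have i₂ : IsSplitEpi (base q') := IsSplitEpi.mk' { section_ := b', id := h₂' }
  have m₁ : IsMonHom (b ≫ base q') := by
    have : IsMonHom (base q ≫ b ≫ base q') := by rw [e]; infer_instance
    exact isMonHom_of_splitEpi (base q) _
  have m₂ : IsMonHom (b' ≫ base q) := by
    have : IsMonHom (base q' ≫ b' ≫ base q) := by rw [e']; infer_instance
    exact isMonHom_of_splitEpi (base q') _
  refine ⟨⟨ofBase _ m₁, ofBase _ m₂, base_ext ?_, base_ext ?_⟩, base_ext e⟩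
  · rw [← cancel_epi (base q)]
    simp only [base_comp, base_ofBase, base_id]
    rw [Category.assoc, reassoc_of% e, e', Category.comp_id]
  · rw [← cancel_epi (base q')]
    simp only [base_comp, base_ofBase, base_id]
    rw [Category.assoc, reassoc_of% e', e, Category.comp_id]

lemma base_hom_inv {S S' : CommMon C} (s : S ≅ S') : base s.hom ≫ base s.inv = 𝟙 _ := by
  rw [← base_comp, s.hom_inv_id, base_id]

lemma base_inv_hom {S S' : CommMon C} (s : S ≅ S') : base s.inv ≫ base s.hom = 𝟙 _ :=
  base_hom_inv s.symm

lemma IsRingProduct.of_iso {S S' Q Q' T : CommMon C} {p : Q ⟶ S} {q : Q ⟶ T}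
    (h : IsRingProduct p q) (e : Q' ≅ Q) (s : S ≅ S') :
    IsRingProduct (e.hom ≫ p ≫ s.hom) (e.hom ≫ q) := by
  obtain ⟨a, b, h₁, h₂, h₃, h₄, h₅⟩ := (isRingProduct_iff p q).1 h
  refine (isRingProduct_iff _ _).2 ⟨base s.inv ≫ a ≫ base e.inv, b ≫ base e.inv, ?_, ?_, ?_, ?_, ?_⟩
  · simp only [base_comp, Category.assoc]
    rw [reassoc_of% (base_inv_hom e), reassoc_of% h₁, base_inv_hom]
  · simp only [base_comp, Category.assoc]
    rw [reassoc_of% (base_inv_hom e), h₂]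
  · simp only [base_comp, Category.assoc]
    rw [reassoc_of% (base_inv_hom e), h₃, comp_zero]
  · simp only [base_comp, Category.assoc]
    rw [reassoc_of% (base_inv_hom e), reassoc_of% h₄, zero_comp]
  · simp only [base_comp, Category.assoc]
    rw [reassoc_of% (base_hom_inv s), ← Preadditive.comp_add, ← Category.assoc, ← Category.assoc,
      ← Preadditive.add_comp, h₅, Category.id_comp, base_hom_inv]

end Products

variable [SymmetricCategory C] [Preadditive C] [MonoidalPreadditive C]

/-- The pushout property identifies the two relative tensor products; the identification respects
the multiplications, hence also their complements. -/
lemma IsSplittingStep.exists_iso {R S T R' S' T' : CommMon C} [IsSeparableMon R.X]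
    [IsSeparableMon R'.X] {f : R ⟶ S} {g : S ⟶ T} {f' : R' ⟶ S'} {g' : S' ⟶ T'}
    (h : IsSplittingStep f g) (h' : IsSplittingStep f' g') (r : R ≅ R') (s : S ≅ S')
    (w : f ≫ s.hom = r.hom ≫ f') : ∃ t : T ≅ T', g ≫ t.hom = s.hom ≫ g' := by
  obtain ⟨Q, i, j, p, q, hQ, hp, hi, hj, rfl⟩ := h
  obtain ⟨Q', i', j', p', q', hQ', hp', hi', hj', rfl⟩ := h'
  have w' : f' ≫ s.inv = r.inv ≫ f := by
    rw [Iso.comp_inv_eq, Category.assoc, w, Iso.inv_hom_id_assoc]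
  obtain ⟨t, ht₁, ht₂⟩ := hQ.exists_desc (s.hom ≫ i') (s.hom ≫ j')
    (by rw [reassoc_of% w, reassoc_of% w, hQ'.condition])
  obtain ⟨t', ht₁', ht₂'⟩ := hQ'.exists_desc (s.inv ≫ i) (s.inv ≫ j)
    (by rw [reassoc_of% w', reassoc_of% w', hQ.condition])
  let e : Q ≅ Q' := ⟨t, t', hQ.hom_ext (by rw [reassoc_of% ht₁, ht₁']; simp)
      (by rw [reassoc_of% ht₂, ht₂']; simp), hQ'.hom_ext (by rw [reassoc_of% ht₁', ht₁]; simp)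
      (by rw [reassoc_of% ht₂', ht₂]; simp)⟩
  -- Both sides are ring maps out of the pushout restricting to the identity along `i` and `j`.
  have hp'' : e.hom ≫ p' ≫ s.symm.hom = p :=
    hQ.hom_ext (by change i ≫ t ≫ _ ≫ s.inv = _; rw [reassoc_of% ht₁, reassoc_of% hi', hi]; simp)
      (by change j ≫ t ≫ _ ≫ s.inv = _; rw [reassoc_of% ht₂, reassoc_of% hj', hj]; simp)
  have hprod := hp'.of_iso e s.symm
  rw [hp''] at hprod
  obtain ⟨τ, hτ⟩ := hp.exists_iso hprod
  refine ⟨τ, ?_⟩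
  rw [Category.assoc, hτ]
  change i ≫ t ≫ q' = _
  rw [reassoc_of% ht₁]

/-- Splitting towers are unique up to isomorphism. -/
lemma SplittingTower.nonempty_iso {A : CommMon C} (T T' : SplittingTower A) (n : ℕ) :
    Nonempty (T.obj n ≅ T'.obj n) := by
  -- The next stage depends on a transition map, so the induction carries two consecutive
  -- isomorphisms and their compatibility.
  suffices h : ∀ n, ∃ (r : T.obj n ≅ T'.obj n) (s : T.obj (n + 1) ≅ T'.obj (n + 1)),
      T.map n ≫ s.hom = r.hom ≫ T'.map n from ⟨(h n).choose⟩
  intro n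
  induction n with
  | zero =>
    refine ⟨T.isoZero ≪≫ T'.isoZero.symm, T.isoOne ≪≫ T'.isoOne.symm, ?_⟩
    -- Moving to the trivial ring as source makes the equation automatic, as it is initial.
    rw [← cancel_epi T.isoZero.inv]
    exact Subsingleton.elim _ _
  | succ n ih =>
    obtain ⟨r, s, w⟩ := ih
    have := T.separable n
    have := T'.separable n
    obtain ⟨t, ht⟩ := (T.step n).exists_iso (T'.step n) r s w
    exact ⟨s, t, ht⟩

end Uniqueness

/-! ### Splitting towers under strong monoidal additive functors. -/

section Functoriality

variable [SymmetricCategory C] [Preadditive C] {D : Type u'} [Category.{v'} D] [MonoidalCategory D]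
  [BraidedCategory D] [Preadditive D] (F : C ⥤ D) [F.LaxBraided] [F.Additive]
  [∀ X Y, IsIso (Functor.LaxMonoidal.μ F X Y)]

/-- Separability of `R` makes the relative tensor product a split coequalizer, and the product is a
biproduct; both are equational, so `F` carries them over. -/
lemma IsSplittingStep.map {R S T : CommMon C} [IsSeparableMon R.X] {f : R ⟶ S} {g : S ⟶ T}
    (h : IsSplittingStep f g) :
    IsSplittingStep (F.mapCommMon.map f) (F.mapCommMon.map g) := by
  obtain ⟨Q, i, j, p, q, hQ, hp, hi, hj, rfl⟩ := h
  refine ⟨F.mapCommMon.obj Q, F.mapCommMon.map i, F.mapCommMon.map j, F.mapCommMon.map p,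
    F.mapCommMon.map q, IsRelTensorHom.map (f := base f) (f' := base f) (i := base i) (j := base j) F hQ,
    ?_, ?_, ?_, ?_⟩
  · obtain ⟨a, b, h₁, h₂, h₃, h₄, h₅⟩ := (isRingProduct_iff p q).1 hp
    refine (isRingProduct_iff _ _).2 ⟨F.map a, F.map b, ?_, ?_, ?_, ?_, ?_⟩
    · exact (F.map_comp _ _).symm.trans ((congrArg F.map h₁).trans (F.map_id _))
    · exact (F.map_comp _ _).symm.trans ((congrArg F.map h₂).trans (F.map_id _))
    · exact (F.map_comp _ _).symm.trans ((congrArg F.map h₃).trans (F.map_zero _ _))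
    · exact (F.map_comp _ _).symm.trans ((congrArg F.map h₄).trans (F.map_zero _ _))
    · change F.map (base p) ≫ F.map a + F.map (base q) ≫ F.map b = 𝟙 (F.obj Q.X)
      rw [← F.map_comp, ← F.map_comp, ← F.map_add, h₅, F.map_id]
  · rw [← Functor.map_comp, hi, CategoryTheory.Functor.map_id]
  · rw [← Functor.map_comp, hj, CategoryTheory.Functor.map_id]
  · rw [← Functor.map_comp]

open scoped Obj in
/-- A functor with invertible unit comparison preserves the trivial commutative monoid object. -/
noncomputable def mapTrivialIso [IsIso (Functor.LaxMonoidal.ε F)] :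
    CommMon.trivial D ≅ F.mapCommMon.obj (CommMon.trivial C) :=
  letI e : (CommMon.trivial D).X ≅ (F.mapCommMon.obj (CommMon.trivial C)).X :=
    @asIso _ _ _ _ (Functor.LaxMonoidal.ε F) ‹_›
  have he : IsMonHom (Functor.LaxMonoidal.ε F) := inferInstance
  CommMon.mkIso e he.one_hom he.mul_hom

/-- The image of a splitting tower under a strong symmetric monoidal additive functor. -/
noncomputable def SplittingTower.mapTower [IsIso (Functor.LaxMonoidal.ε F)] {A : CommMon C}
    (T : SplittingTower A) : SplittingTower (F.mapCommMon.obj A) where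
  obj n := F.mapCommMon.obj (T.obj n)
  separable n :=
    have := T.separable n
    IsSeparableMon.map F (T.obj n).X
  map n := F.mapCommMon.map (T.map n)
  isoZero := F.mapCommMon.mapIso T.isoZero ≪≫
    (mapTrivialIso F).symm
  isoOne := F.mapCommMon.mapIso T.isoOne
  step n :=
    have := T.separable n
    (T.step n).map F

end Functoriality

/-! ### Degrees computed from a tower. -/

section Degree

variable [SymmetricCategory C] [Preadditive C] [MonoidalPreadditive C]

lemma CategoryTheory.CommMon.isZero_iff {A B : CommMon C} (e : A ≅ B) : IsZero A.X ↔ IsZero B.X :=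
  ((CommMon.forget C).mapIso e).isZero_iff

/-- The degree can be computed with any splitting tower. -/
lemma SplittingTower.ringDegree_eq {A : CommMon C} (T : SplittingTower A) :
    ringDegree A = ⨆ (n : ℕ) (_ : ¬ IsZero (T.obj n).X), (n : ℕ∞) := by
  apply le_antisymm
  · refine iSup_le fun T' => iSup₂_le fun n hn => le_iSup₂_of_le n ?_ le_rfl
    rwa [CommMon.isZero_iff (T.nonempty_iso T' n).some]
  · exact le_iSup (fun T : SplittingTower A =>
      ⨆ (n : ℕ) (_ : ¬ IsZero (T.obj n).X), (n : ℕ∞)) T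

variable {D : Type u'} [Category.{v'} D] [MonoidalCategory D]
  [SymmetricCategory D] [Preadditive D] [MonoidalPreadditive D]
  (F : C ⥤ D) [F.LaxBraided] [F.Additive]
  [∀ X Y, IsIso (Functor.LaxMonoidal.μ F X Y)] [IsIso (Functor.LaxMonoidal.ε F)]

/-- An additive functor preserves zero objects, so a nonzero stage of the image tower comes from a
nonzero stage. -/
lemma SplittingTower.ringDegree_map_le {A : CommMon C} (T : SplittingTower A) :
    ringDegree (F.mapCommMon.obj A) ≤ ringDegree A := by
  rw [T.ringDegree_eq, (T.mapTower F).ringDegree_eq]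
  exact iSup₂_le fun n hn => le_iSup₂_of_le n (fun h => hn (F.map_isZero h)) le_rfl

/-- The degree is preserved by a functor which does not kill any nonzero stage of positive index
of the splitting tower. -/
lemma SplittingTower.ringDegree_map_eq {A : CommMon C} (T : SplittingTower A)
    (h : ∀ n, IsZero (F.obj (T.obj (n + 1)).X) → IsZero (T.obj (n + 1)).X) :
    ringDegree (F.mapCommMon.obj A) = ringDegree A := by
  refine le_antisymm (T.ringDegree_map_le F) ?_
  rw [T.ringDegree_eq, (T.mapTower F).ringDegree_eq]
  refine iSup₂_le fun n hn => ?_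
  obtain _ | n := n
  -- Stage `0` contributes only `0` to the supremum, so it is harmless if `F` kills the unit.
  · simp
  · exact le_iSup₂_of_le (n + 1) (fun h' => hn (h n h')) le_rfl

end Degree

end Towers

/-! ### The additive structure on modules. -/

section ModulePreadditive

open scoped MonObj
open RelTensor

variable {C : Type u} [Category.{v} C] [MonoidalCategory C] [SymmetricCategory C] [Preadditive C]
  [MonoidalPreadditive C]

lemma RelTensor.mod_hom_injective {B : C} [MonObj B] {X Y : Mod C B} :
    Function.Injective (fun f : X ⟶ Y => f.hom) := fun _ _ h => Mod.hom_ext _ _ h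

section Group

variable {B : C} [MonObj B] (X Y : Mod C B)

instance modHomZero : Zero (X ⟶ Y) := ⟨mkHom 0 (by simp)⟩

instance modHomAdd : Add (X ⟶ Y) := ⟨fun f g => mkHom (f.hom + g.hom) (by simp [lact_hom])⟩

instance modHomNeg : Neg (X ⟶ Y) := ⟨fun f => mkHom (-f.hom) (by
  have h : B ◁ (-f.hom) = -(B ◁ f.hom) := (tensorLeft B).map_neg
  simp [lact_hom, h])⟩

instance modHomSub : Sub (X ⟶ Y) := ⟨fun f g => mkHom (f.hom - g.hom) (by
  have h : B ◁ (f.hom - g.hom) = B ◁ f.hom - B ◁ g.hom := (tensorLeft B).map_sub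
  simp [lact_hom, h])⟩

instance modHomNSMul : SMul ℕ (X ⟶ Y) := ⟨fun n f => mkHom (n • f.hom) (by
  have h : B ◁ (n • f.hom) = n • B ◁ f.hom := (tensorLeft B).map_nsmul
  simp [lact_hom, h])⟩

instance modHomZSMul : SMul ℤ (X ⟶ Y) := ⟨fun n f => mkHom (n • f.hom) (by
  have h : B ◁ (n • f.hom) = n • B ◁ f.hom := (tensorLeft B).map_zsmul
  simp [lact_hom, h])⟩

instance modHomAddCommGroup : AddCommGroup (X ⟶ Y) :=
  Function.Injective.addCommGroup (fun f : X ⟶ Y => f.hom) mod_hom_injective rfl (fun _ _ => rfl)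
    (fun _ => rfl) (fun _ _ => rfl) (fun _ _ => rfl) (fun _ _ => rfl)

end Group

section Mod

variable {B : C} [MonObj B]

instance modPreadditive : Preadditive (Mod C B) where
  homGroup X Y := modHomAddCommGroup X Y
  add_comp _ _ _ f f' g := Mod.hom_ext _ _ (by
    change (f.hom + f'.hom) ≫ g.hom = f.hom ≫ g.hom + f'.hom ≫ g.hom
    exact Preadditive.add_comp _ _ _ _ _ _)
  comp_add _ _ _ f g g' := Mod.hom_ext _ _ (by
    change f.hom ≫ (g.hom + g'.hom) = f.hom ≫ g.hom + f.hom ≫ g'.hom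
    exact Preadditive.comp_add _ _ _ _ _ _)

lemma mod_add_hom {X Y : Mod C B} (f g : X ⟶ Y) : (f + g).hom = f.hom + g.hom := rfl

lemma mod_zero_hom {X Y : Mod C B} : (0 : X ⟶ Y).hom = 0 := rfl

instance freeModAdditive : (freeMod B).Additive where
  map_add := Mod.hom_ext _ _ (MonoidalPreadditive.whiskerLeft_add _ _)

end Mod

/-- A module is zero only if its underlying object is. -/
lemma isZero_of_isZero_mod {B : C} [MonObj B] {X : Mod C B} (h : IsZero X) : IsZero X.X := by
  rw [IsZero.iff_id_eq_zero] at h ⊢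
  exact congrArg Mod.Hom.hom h

end ModulePreadditive

/-! ### Extension of scalars is strong monoidal. -/

section ModuleTensor

open scoped MonObj
open RelTensor

variable {C : Type u} [Category.{v} C] [MonoidalCategory C] [SymmetricCategory C]
  [IsIdempotentComplete C] {B : C} [MonObj B] [IsCommMonObj B] [IsSeparableMon B]

instance modMonoidalPreadditive [Preadditive C] [MonoidalPreadditive C] :
    MonoidalPreadditive (Mod C B) where
  whiskerLeft_zero {X Y Z} := by
    change tensHom (𝟙 X) (0 : Y ⟶ Z) = 0
    exact tens_hom_ext (by simp [pr_tensHom, mod_zero_hom])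
  zero_whiskerRight {X Y Z} := by
    change tensHom (0 : Y ⟶ Z) (𝟙 X) = 0
    exact tens_hom_ext (by simp [pr_tensHom, mod_zero_hom])
  whiskerLeft_add {X Y Z} f g := by
    change tensHom (𝟙 X) (f + g) = tensHom (𝟙 X) f + tensHom (𝟙 X) g
    exact tens_hom_ext (by simp [pr_tensHom, mod_add_hom])
  add_whiskerRight {X Y Z} f g := by
    change tensHom (f + g) (𝟙 X) = tensHom f (𝟙 X) + tensHom g (𝟙 X)
    exact tens_hom_ext (by simp [pr_tensHom, mod_add_hom])

lemma isIso_mod {X Y : Mod C B} (f : X ⟶ Y) [IsIso f.hom] : IsIso f :=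
  ⟨mkHom (inv f.hom) (by
      rw [← cancel_epi (B ◁ f.hom), ← MonoidalCategory.whiskerLeft_comp_assoc, IsIso.hom_inv_id,
        MonoidalCategory.whiskerLeft_id, Category.id_comp]
      have h := lact_hom f
      rw [← reassoc_of% h, IsIso.hom_inv_id, Category.comp_id]),
    Mod.hom_ext _ _ (IsIso.hom_inv_id f.hom), Mod.hom_ext _ _ (IsIso.inv_hom_id f.hom)⟩

variable (B)

instance isIso_freeMod_ε : IsIso (Functor.LaxMonoidal.ε (freeMod B)) := by
  change IsIso (freeε B)
  have : IsIso (freeε B).hom := inferInstanceAs (IsIso (ρ_ B).inv)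
  exact isIso_mod _

/-- The morphism `B ⊗ (x ⊗ y) ⟶ (B ⊗ x) ⊗ (B ⊗ y)` inserting the unit of `B`. -/
def freeIns (x y : C) : B ⊗ (x ⊗ y) ⟶ (B ⊗ x) ⊗ (B ⊗ y) :=
  (α_ B x y).inv ≫ (B ⊗ x) ◁ ((λ_ y).inv ≫ η[B] ▷ y)

lemma freeIns_freeMul (x y : C) : freeIns B x y ≫ freeMul B x y = 𝟙 _ := by
  rw [freeIns, freeMul_eq, Category.assoc, associator_naturality_right_assoc,
    ← MonoidalCategory.whiskerLeft_comp_assoc]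
  have h : x ◁ ((λ_ y).inv ≫ η[B] ▷ y) ≫ (α_ x B y).inv ≫ (β_ x B).hom ▷ y ≫ (α_ B x y).hom =
      (λ_ _).inv ≫ η[B] ▷ (x ⊗ y) := by
    rw [MonoidalCategory.whiskerLeft_comp_assoc, associator_inv_naturality_middle_assoc,
      ← comp_whiskerRight_assoc, BraidedCategory.braiding_naturality_right,
      braiding_tensorUnit_right]
    monoidal
  rw [h, MonoidalCategory.whiskerLeft_comp_assoc, associator_inv_naturality_middle_assoc,
    ← comp_whiskerRight, MonObj.mul_one]
  monoidal

/-- Multiplying the two copies of `B` is the same as letting the second act from the right on `B ⊗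
x`. In this form balancedness of `pr` applies. -/
lemma freeMul_assoc_inv (x y : C) : freeMul B x y ≫ (α_ B x y).inv =
    (α_ (B ⊗ x) B y).inv ≫ ract (freeObj B x) ▷ y := by
  have e₀ : ract (freeObj B x) = (α_ B x B).hom ≫ B ◁ (β_ x B).hom ≫ (α_ B B x).inv ≫ μ[B] ▷ x := by
    change (β_ (B ⊗ x) B).hom ≫ (α_ B B x).inv ≫ μ[B] ▷ x = _
    simp [← comp_whiskerRight]
  rw [freeMul_eq, e₀]
  monoidal

/-- In the tensor product over `B`, `(bb' ⊗ x) ⊗ (1 ⊗ y) = (b ⊗ x) ⊗ (b' ⊗ y)`: the scalar `b'`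
moves across and acts on the unit. -/
lemma freeMul_freeIns_pr (x y : C) : freeMul B x y ≫ freeIns B x y ≫
    pr (freeObj B x) (freeObj B y) = pr (freeObj B x) (freeObj B y) := by
  have h := pr_balanced (freeObj B x) (freeObj B y)
  have h' : B ◁ ((λ_ y).inv ≫ η[B] ▷ y) ≫ lact (freeObj B y) = 𝟙 _ := by
    change B ◁ ((λ_ y).inv ≫ η[B] ▷ y) ≫ (α_ B B y).inv ≫ μ[B] ▷ y = _
    rw [MonoidalCategory.whiskerLeft_comp_assoc, associator_inv_naturality_middle_assoc,
      ← comp_whiskerRight, MonObj.mul_one]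
    simp
  have k := freeMul_assoc_inv B x y
  rw [freeIns, Category.assoc, reassoc_of% k, ← whisker_exchange_assoc, h,
    ← associator_inv_naturality_right_assoc, Iso.inv_hom_id_assoc,
    ← MonoidalCategory.whiskerLeft_comp_assoc, h']
  simp

instance isIso_freeMod_μ (x y : C) : IsIso (Functor.LaxMonoidal.μ (freeMod B) x y) := by
  change IsIso (freeμ B x y)
  have : IsIso (freeμ B x y).hom := by
    -- The inverse sends `b ⊗ x ⊗ y` to the class of `(b ⊗ x) ⊗ (1 ⊗ y)`.
    refine ⟨freeIns B x y ≫ pr (freeObj B x) (freeObj B y), ?_, ?_⟩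
    · rw [← cancel_epi (pr (freeObj B x) (freeObj B y)), pr_freeμ_assoc, freeMul_freeIns_pr]
      simp
    · rw [Category.assoc, pr_freeμ, freeIns_freeMul]
  exact isIso_mod _

end ModuleTensor

/-! ### Bilinearity of an exact tensor product. -/

section Additivity

variable {K : Type u} [Category.{v} K] [Preadditive K] [HasZeroObject K] [HasShift K ℤ]
  [∀ n : ℤ, (shiftFunctor K n).Additive] [Pretriangulated K] [MonoidalCategory K]

/-- Exact functors between triangulated categories are additive, so exactness in each variable
already makes the tensor product bilinear on morphisms. -/
instance (priority := 100) IsTensorTriangulated.tensorLeft_additive [IsTensorTriangulated K]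
    (x : K) : (tensorLeft x).Additive :=
  have ⟨_, _⟩ := IsTensorTriangulated.exact_left x
  inferInstance

instance (priority := 100) IsTensorTriangulated.tensorRight_additive [IsTensorTriangulated K]
    (x : K) : (tensorRight x).Additive :=
  have ⟨_, _⟩ := IsTensorTriangulated.exact_right x
  inferInstance

instance (priority := 100) IsTensorTriangulated.monoidalPreadditive [IsTensorTriangulated K] :
    MonoidalPreadditive K where
  whiskerLeft_zero {X _ _} := (tensorLeft X).map_zero _ _
  zero_whiskerRight {X _ _} := (tensorRight X).map_zero _ _
  whiskerLeft_add {X _ _} _ _ := (tensorLeft X).map_add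
  add_whiskerRight {X _ _} _ _ := (tensorRight X).map_add

end Additivity

/-! ### Nilpotent rings vanish. -/

section Nilpotence

open scoped MonObj

variable {C : Type u} [Category.{v} C] [MonoidalCategory C]

/-- Tensor powers add up. -/
lemma nonempty_tensorPower_add (x : C) (k m : ℕ) :
    Nonempty (tensorPower x k ⊗ tensorPower x m ≅ tensorPower x (k + m)) := by
  induction m with
  | zero => exact ⟨ρ_ _⟩
  | succ m ih => exact ⟨(α_ _ _ _).symm ≪≫ whiskerRightIso ih.some x⟩

/-- A ring object is a retract of its tensor product with a ring object over it. -/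
def retractTensorOfHom {R S : C} [MonObj R] [MonObj S] (f : R ⟶ S) [IsMonHom f] :
    Retract S (R ⊗ S) where
  i := (λ_ S).inv ≫ η[R] ▷ S
  r := f ▷ S ≫ μ
  retract := by
    rw [Category.assoc, ← comp_whiskerRight_assoc, IsMonHom.one_hom, MonObj.one_mul,
      Iso.inv_hom_id]

/-- `X ⊗ R` is a retract of `(X ⊗ R) ⊗ R` for a ring object `R`. -/
def retractTensorSelf (X R : C) [MonObj R] : Retract (X ⊗ R) ((X ⊗ R) ⊗ R) where
  i := X ◁ ((λ_ R).inv ≫ η[R] ▷ R) ≫ (α_ X R R).inv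
  r := (α_ X R R).hom ≫ X ◁ μ
  retract := by
    rw [Category.assoc, Iso.inv_hom_id_assoc, ← MonoidalCategory.whiskerLeft_comp, Category.assoc,
      MonObj.one_mul, Iso.inv_hom_id, MonoidalCategory.whiskerLeft_id]

variable [Preadditive C] [MonoidalPreadditive C]

lemma isZero_tensor_left {X : C} (h : IsZero X) (Y : C) : IsZero (X ⊗ Y) := by
  rw [IsZero.iff_id_eq_zero] at h ⊢
  rw [← id_whiskerRight, h, MonoidalPreadditive.zero_whiskerRight]

lemma isZero_of_retract {X Y : C} (h : Retract X Y) (hY : IsZero Y) : IsZero X := by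
  rw [IsZero.iff_id_eq_zero, ← h.retract, hY.eq_of_tgt h.i 0, zero_comp]

/-- A `⊗`-nilpotent ring object is zero. -/
lemma isZero_of_isTensorNilpotent {R : C} [MonObj R] (h : IsTensorNilpotent R) : IsZero R := by
  obtain ⟨m, hm⟩ := h
  -- Only positive powers are retracts of the next one, so the descent ends at `R^{⊗ 1} ≅ R`; a
  -- vanishing zeroth power is covered by tensoring once more.
  suffices H : ∀ m, IsZero (tensorPower R (m + 1)) → IsZero R from
    H m (isZero_tensor_left hm R)
  intro m
  induction m with
  | zero => exact fun h => h.of_iso (λ_ R).symm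
  | succ m ih =>
    exact fun h => ih (isZero_of_retract (retractTensorSelf (tensorPower R m) R) h)

end Nilpotence

/-! ### Thick ideals, primes and nilpotence. -/

section Primes

open ObjectProperty Pretriangulated
open scoped ZeroObject

variable {K : Type u} [Category.{v} K] [Preadditive K] [HasZeroObject K] [HasShift K ℤ]
  [∀ n : ℤ, (shiftFunctor K n).Additive] [Pretriangulated K] [MonoidalCategory K]

/-- Thick triangulated `⊗`-ideals of a symmetric tensor-triangulated category. -/
structure IsThickTTIdeal (P : ObjectProperty K) : Prop where
  triangulated : P.IsTriangulated
  thick : P.IsStableUnderRetracts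
  tensor_mem : ∀ x y : K, P x → P (x ⊗ y)

lemma IsPrimeTTIdeal.isThickTTIdeal {P : ObjectProperty K} (h : IsPrimeTTIdeal P) :
    IsThickTTIdeal P :=
  ⟨h.triangulated, h.thick, h.tensor_mem⟩

lemma IsThickTTIdeal.of_iso {P : ObjectProperty K} (h : IsThickTTIdeal P) {x y : K} (e : x ≅ y)
    (hx : P x) : P y :=
  have := h.thick
  P.prop_of_iso e hx

lemma IsThickTTIdeal.of_isZero {P : ObjectProperty K} (h : IsThickTTIdeal P) {x : K}
    (hx : IsZero x) : P x :=
  have := h.thick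
  have := h.triangulated
  P.prop_of_isZero hx

/-- The zero objects form a thick `⊗`-ideal. -/
lemma isThickTTIdeal_isZero [IsTensorTriangulated K] :
    IsThickTTIdeal (IsZero : ObjectProperty K) := by
  have h₀ : IsStableUnderRetracts (IsZero : ObjectProperty K) := ⟨fun h hY => isZero_of_retract h hY⟩
  exact
  { triangulated :=
      { exists_zero := ⟨0, isZero_zero K, isZero_zero K⟩
        isStableUnderShiftBy n := ⟨fun _ hx => (shiftFunctor K n).map_isZero hx⟩
        toIsTriangulatedClosed₂ := .mk' fun T hT h₁ h₃ => T.isZero₂_of_isZero₁₃ hT h₁ h₃ }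
    thick := h₀
    tensor_mem _ y hx := isZero_tensor_left hx y }

/-- The union of a nonempty chain of thick `⊗`-ideals is one. -/
lemma isThickTTIdeal_sSup {c : Set (ObjectProperty K)} (hc : IsChain (· ≤ ·) c)
    (h : ∀ P ∈ c, IsThickTTIdeal P) {P₀ : ObjectProperty K} (h₀ : P₀ ∈ c) :
    IsThickTTIdeal (fun x => ∃ P ∈ c, P x) := by
  have hr : IsStableUnderRetracts (fun x : K => ∃ P ∈ c, P x) :=
    ⟨fun {_ _} r ⟨P, hP, hx⟩ => ⟨P, hP, (h P hP).thick.of_retract r hx⟩⟩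
  exact
  { triangulated :=
      { exists_zero := ⟨0, isZero_zero K, P₀, h₀, (h P₀ h₀).of_isZero (isZero_zero K)⟩
        isStableUnderShiftBy n := ⟨fun x ⟨P, hP, hx⟩ =>
          ⟨P, hP, have := (h P hP).triangulated; P.le_shift n x hx⟩⟩
        toIsTriangulatedClosed₂ := .mk' fun T hT ⟨P, hP, h₁⟩ ⟨Q, hQ, h₃⟩ => by
          -- The outer vertices of a triangle lie in a common member of the chain.
          obtain ⟨R, hR, h₁, h₃⟩ : ∃ R ∈ c, R T.obj₁ ∧ R T.obj₃ := by
            rcases hc.total hP hQ with l | l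
            · exact ⟨Q, hQ, l _ h₁, h₃⟩
            · exact ⟨P, hP, h₁, l _ h₃⟩
          have := (h R hR).triangulated
          have := (h R hR).thick
          exact ⟨R, hR, R.ext_of_isTriangulatedClosed₂ T hT h₁ h₃⟩ }
    thick := hr
    tensor_mem x y := fun ⟨P, hP, hx⟩ => ⟨P, hP, (h P hP).tensor_mem x y hx⟩ }

variable [IsTensorTriangulated K]

/-- The quotient ideal `(P : a)`. -/
lemma IsThickTTIdeal.colon {P : ObjectProperty K} (h : IsThickTTIdeal P) (a : K) :
    IsThickTTIdeal (P.inverseImage (tensorLeft a)) := by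
  -- `(P : a)` is the preimage of `P` under the functor `a ⊗ -`, whose exactness makes it
  -- triangulated.
  obtain ⟨_, _⟩ := IsTensorTriangulated.exact_left a
  have := h.thick
  have := h.triangulated
  exact
  { triangulated := inferInstance
    thick := ⟨fun r hy => P.prop_of_retract (r.map (tensorLeft a)) hy⟩
    tensor_mem x y hx := h.of_iso (α_ a x y) (h.tensor_mem _ y hx) }

variable [SymmetricCategory K]

lemma IsThickTTIdeal.tensor_mem' {P : ObjectProperty K} (h : IsThickTTIdeal P) (x y : K)
    (hy : P y) : P (x ⊗ y) :=
  h.of_iso (β_ y x) (h.tensor_mem y x hy)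

/-- A thick `⊗`-ideal which is maximal among those not containing any tensor power of `x` is
prime. -/
lemma isPrimeTTIdeal_of_maximal {x : K} {P : ObjectProperty K}
    (h : Maximal (fun P : ObjectProperty K => IsThickTTIdeal P ∧ ∀ m, ¬ P (tensorPower x m)) P) :
    IsPrimeTTIdeal P := by
  obtain ⟨⟨hP, hx⟩, hmax⟩ := h
  -- The ideal `(P : a)` contains `P` and also `b ∉ P`, so by maximality it contains a power of `x`.
  have key : ∀ a b : K, P (a ⊗ b) → ¬ P b → ∃ m, P (a ⊗ tensorPower x m) := by
    intro a b hab hb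
    by_contra! hm
    exact hb (hmax (y := P.inverseImage (tensorLeft a)) ⟨hP.colon a, hm⟩
      (fun c hc => hP.tensor_mem' a c hc) b hab)
  refine ⟨hP.triangulated, hP.thick, hP.tensor_mem, hP.tensor_mem', ⟨_, hx 0⟩, fun a b hab => ?_⟩
  by_contra! hn
  obtain ⟨m, hm⟩ := key a b hab hn.2
  -- A second application, with the power `x^{⊗ m}` in place of `a` and `a` in place of `b`, puts
  -- `x^{⊗ m} ⊗ x^{⊗ k}` in `P`.
  obtain ⟨k, hk⟩ := key _ a (hP.of_iso (β_ _ _) hm) hn.1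
  exact hx _ (hP.of_iso (nonempty_tensorPower_add x m k).some hk)

/-- An object lying in all primes is `⊗`-nilpotent. -/
lemma isTensorNilpotent_of_forall_prime {x : K} (h : ∀ P : Spc K, P.1 x) :
    IsTensorNilpotent x := by
  by_contra hx
  -- Zorn starts from the zero ideal, which contains no power of `x` because `x` is not nilpotent.
  obtain ⟨P, -, hP⟩ := zorn_le_nonempty₀
    {P : ObjectProperty K | IsThickTTIdeal P ∧ ∀ m, ¬ P (tensorPower x m)}
    (fun c hc hch P₀ h₀ => ⟨fun y => ∃ P ∈ c, P y,
      ⟨isThickTTIdeal_sSup hch (fun P hP => (hc hP).1) h₀,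
        fun m ⟨P, hP, hm⟩ => (hc hP).2 m hm⟩, fun P hP y hy => ⟨P, hP, hy⟩⟩)
    IsZero ⟨isThickTTIdeal_isZero, fun m hm => hx ⟨m, hm⟩⟩
  -- The resulting prime contains `x`, hence the first power `𝟙 ⊗ x`, a contradiction.
  refine hP.prop.2 1 (hP.prop.1.of_iso (λ_ x).symm (h ⟨P, isPrimeTTIdeal_of_maximal hP⟩))

/-- An `R`-algebra `S` is a retract of `R ⊗ S`, so every prime containing `R` contains `S`. -/
lemma ttSupp_subset_of_hom {R S : CommMon K} (f : R ⟶ S) : ttSupp S.X ⊆ ttSupp R.X :=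
  fun P hS hR => hS (P.2.thick.of_retract (retractTensorOfHom (CommMon.base f))
    (P.2.tensor_mem _ _ hR))

end Primes

/-! ### The theorem. -/

section Main

open scoped ZeroObject

variable {K : Type u} [Category.{v} K] [MonoidalCategory K] [SymmetricCategory K]

/-- All stages of positive index of a splitting tower of `A` are `A`-algebras. -/
lemma SplittingTower.nonempty_hom {A : CommMon K} (T : SplittingTower A) (n : ℕ) :
    Nonempty (A ⟶ T.obj (n + 1)) := by
  induction n with
  | zero => exact ⟨T.isoOne.inv⟩
  | succ n ih => exact ⟨ih.some ≫ T.map (n + 1)⟩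

/-- If `F(x) = 0` then `F` sends `x ⟶ 0` to an isomorphism, so `x` is already zero and its first
tensor power vanishes. -/
lemma weaklyConservativeOn_of_reflectsIsomorphisms [Preadditive K] [HasZeroObject K]
    [HasShift K ℤ] [∀ n : ℤ, (shiftFunctor K n).Additive] [Pretriangulated K]
    {L : Type u'} [Category.{v'} L] [Preadditive L] (F : K ⥤ L) [F.Additive]
    [F.ReflectsIsomorphisms] (Y : Set (Spc K)) : WeaklyConservativeOn F Y := by
  intro x _ hx
  have : IsIso (F.map (0 : x ⟶ 0)) :=
    ⟨0, hx.eq_of_src _ _, (F.map_isZero (isZero_zero K)).eq_of_src _ _⟩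
  have := isIso_of_reflects_iso (0 : x ⟶ 0) F
  exact ⟨1, (isZero_zero K).of_iso (λ_ x ≪≫ asIso (0 : x ⟶ 0))⟩

variable [Preadditive K] [MonoidalPreadditive K] [IsIdempotentComplete K]

/-- The degree is preserved by extension of scalars to a ring `B` whose tensor product with any
nonzero `A`-algebra is nonzero. -/
lemma ringDegree_freeMod_eq (A B : CommMon K) [IsSeparableMon A.X] [IsSeparableMon B.X]
    (h : ∀ S : CommMon K, Nonempty (A ⟶ S) → IsZero (B.X ⊗ S.X) → IsZero S.X) :
    ringDegree A = ringDegree ((RelTensor.freeMod B.X).mapCommMon.obj A) := by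
  obtain ⟨T⟩ := nonempty_splittingTower A
  exact (T.ringDegree_map_eq (RelTensor.freeMod B.X)
    -- The module underlying the extended stage is `B ⊗ A^[n+1]`, and `A^[n+1]` is an `A`-algebra.
    fun n hn => h _ (T.nonempty_hom n) (isZero_of_isZero_mod hn)).symm

end Main

theorem theorem3p6
    {K : Type u} [Category.{v} K] [Preadditive K] [HasZeroObject K] [HasShift K ℤ]
    [∀ n : ℤ, (shiftFunctor K n).Additive] [Pretriangulated K] [IsTriangulated K]
    [MonoidalCategory K] [SymmetricCategory K] [IsTensorTriangulated K] [IsIdempotentComplete K]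
    (A : CommMon K) [IsSeparableMon A.X] :
    -- compatibility of the splitting tower and of the degree with tensor-triangulated functors
    (∀ {L : Type u'} [Category.{v'} L] [Preadditive L] [HasZeroObject L] [HasShift L ℤ]
      [∀ n : ℤ, (shiftFunctor L n).Additive] [Pretriangulated L] [IsTriangulated L]
      [MonoidalCategory L] [SymmetricCategory L] [IsTensorTriangulated L] [IsIdempotentComplete L]
      (F : K ⥤ L) [F.Braided] [F.CommShift ℤ] [F.IsTriangulated],
      (Nonempty (SplittingTower A) ∧ Nonempty (SplittingTower (F.mapCommMon.obj A)) ∧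
        ∀ (T : SplittingTower A) (T' : SplittingTower (F.mapCommMon.obj A)) (n : ℕ),
          Nonempty (T'.obj n ≅ F.mapCommMon.obj (T.obj n))) ∧
      ringDegree (F.mapCommMon.obj A) ≤ ringDegree A ∧
      (WeaklyConservativeOn F (ttSupp A.X) →
        ringDegree (F.mapCommMon.obj A) = ringDegree A) ∧
      (F.ReflectsIsomorphisms → WeaklyConservativeOn F (ttSupp A.X))) ∧
    -- extension of scalars to `B` when the support of `B` contains that of `A`
    (∀ (B : CommMon K) [IsSeparableMon B.X], ttSupp A.X ⊆ ttSupp B.X →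
      ringDegree A = ringDegree ((RelTensor.freeMod B.X).mapCommMon.obj A)) ∧
    -- extension of scalars to a nonzero `B` when `K` is local
    (IsLocalTT K → ∀ (B : CommMon K) [IsSeparableMon B.X], ¬ IsZero B.X →
      ringDegree A = ringDegree ((RelTensor.freeMod B.X).mapCommMon.obj A)) := by
  refine ⟨?_, fun B _ hAB => ?_, fun hK B _ hB => ?_⟩
  · intro L _ _ _ _ _ _ _ _ _ _ _ F _ _ _
    obtain ⟨T₀⟩ := nonempty_splittingTower A
    refine ⟨⟨⟨T₀⟩, ⟨T₀.mapTower F⟩, fun T T' n => T'.nonempty_iso (T.mapTower F) n⟩,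
      T₀.ringDegree_map_le F, fun hF => T₀.ringDegree_map_eq F fun n hn => ?_,
      fun _ => weaklyConservativeOn_of_reflectsIsomorphisms F _⟩
    -- A stage of positive index is an `A`-algebra, so its support lies in `supp A` and weak
    -- conservativity applies to it.
    exact isZero_of_isTensorNilpotent
      (hF _ (ttSupp_subset_of_hom (T₀.nonempty_hom n).some) hn)
  · refine ringDegree_freeMod_eq A B fun S ⟨f⟩ hS => isZero_of_isTensorNilpotent
      (isTensorNilpotent_of_forall_prime fun P => ?_)
    -- A prime omitting `S` contains `B`, since `B ⊗ S = 0`; but it omits `A`, as `S` is an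
    -- `A`-algebra, and hence omits `B` by hypothesis.
    by_contra hP
    rcases P.2.prime _ _ (P.2.isThickTTIdeal.of_isZero hS) with h | h
    · exact hAB (ttSupp_subset_of_hom f hP) h
    · exact hP h
  -- Locality makes `B` or `S` nilpotent, hence zero as a ring, and `B` is not zero.
  · exact ringDegree_freeMod_eq A B fun S _ hS => (hK _ _ hS).elim
      (fun h => (hB (isZero_of_isTensorNilpotent h)).elim) isZero_of_isTensorNilpotent
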